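/- Let $m$ be an odd positive integer such that $q=2m^2+2m+1$ is a power of a prime $p$. Let $\gamma$ be a primitive element of $\mathbb F_q$ and $\omega$ a primitive element of $\mathbb F_{q^2}\supseteq\mathbb F_q$, and put $C_i^{(2,q)}=\gamma^i\langle\gamma^2\rangle$ and $C_j^{(4,q^2)}=\omega^j\langle\omega^4\rangle$ (so $C_0^{(2,q)}$ is the set of nonzero squares of $\mathbb F_q$). Let $\eta$ be the quadratic character of $\mathbb F_q$ and $\chi_4$ the multiplicative character of order $4$ of $\mathbb F_{q^2}$ with $\chi_4(\omega)=i$, where $i=\sqrt{-1}$. For $r\in\{q,q^2\}$ and a multiplicative character $\chi$ of $\mathbb F_r$ let $G_r(\chi)=\sum_{x\in\mathbb F_r^*}\chi(x)\exp\bigl(2\pi i\,\mathrm{Tr}_{\mathbb F_r/\mathbb F_p}(x)/p\bigr)$ be its Gauss sum. Then there are $\epsilon,\delta\in\{1,-1\}$ such that $$\frac{G_q(\eta)\,G_{q^2}(\chi_4)}{q}=\epsilon m+\delta(m+1)i,$$ and there is a pair $(h,\ell)\in\{0,1,2,3\}\times\{0,1,\dots,q^2-2\}$ such that $$(q+1)\nmid\ell,\qquad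 \chi_4(\omega^\ell)=i^{\,3+h},\qquad \chi_4(\omega^{\ell q}-\omega^\ell)=i^{\,\delta(1+2h)}.\qquad(*)$$ Moreover, let $h\in\{0,1,2,3\}$ and let $\ell$ be any integer such that $(*)$ holds. Set $(H_0,H_1)=(\{h,h+1\},\{h+1,h+2\})$ if $\epsilon\delta=1$ and $(H_0,H_1)=(\{h+1,h+2\},\{h,h+1\})$ if $\epsilon\delta=-1$ (indices modulo $4$), and for $d=0,1$ define $$D_{\ell,H_d}=\Bigl\{x\in\mathbb F_q:\ 1+x\omega^\ell\in\bigcup_{j\in H_d}C_j^{(4,q^2)}\Bigr\}.$$ Then $|D_{\ell,H_0}|=m^2$, $|D_{\ell,H_1}|=m^2+m$, $$\bigl\{|D_{\ell,H_0}\cap((C_0^{(2,q)}\cup\{0\})+s)|+|D_{\ell,H_1}\cap(C_0^{(2,q)}+s)|:s\in\mathbb F_q\bigr\}=\{m^2,\;m^2+m+1\},$$ and $$\bigl\{|D_{\ell,H_0}\cap(C_0^{(2,q)}+s)|+|D_{\ell,H_1}\cap((\mathbb F_q^*\setminus C_0^{(2,q)})+s)|:s\in\mathbb F_q\bigr\}=\{m^2-1,\;m^2,\;m^2+m-1,\;m^2+m\}.$$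 -/

import Mathlib

noncomputable section

namespace QuarticIntersection

/-- The cyclotomic class `C_i^{(e,|K|)} = ω^i ⟨ω^e⟩`, a subset of `K`. For a primitive element `ω`
and `e ∣ |K| - 1` it depends on `i` only modulo `e`. -/
def cyclotomicClass {K : Type*} [Field K] (ω : Kˣ) (e i : ℕ) : Set K :=
  {x | ∃ u ∈ Subgroup.zpowers (ω ^ e), x = ((ω ^ i * u : Kˣ) : K)}

/-- The canonical additive character `x ↦ exp (2πi Tr(x) / p)` of a finite field of
characteristic `p`, where `Tr` is the absolute trace. -/
def canonicalAddChar (p : ℕ) [Fact p.Prime] (K : Type*) [Field K] [Algebra (ZMod p) K] :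
    AddChar K ℂ :=
  (ZMod.stdAddChar (N := p)).compAddMonoidHom (Algebra.trace (ZMod p) K).toAddMonoidHom

/-- The Gauss sum of a multiplicative character with respect to the canonical additive character.
(Multiplicative characters in Mathlib vanish at `0`, so this is the sum over nonzero elements.) -/
def canonicalGaussSum (p : ℕ) [Fact p.Prime] {K : Type*} [Field K] [Fintype K]
    [Algebra (ZMod p) K] (χ : MulChar K ℂ) : ℂ :=
  gaussSum χ (canonicalAddChar p K)

/-- The quadratic character with complex values. -/
def quadraticCharC (F : Type*) [Field F] [Fintype F] [DecidableEq F] : MulChar F ℂ :=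
  (quadraticChar F).ringHomComp (Int.castRingHom ℂ)

/-- `D_{ℓ,H} = {x ∈ F : 1 + x ω^ℓ ∈ ⋃_{j ∈ H} C_j^{(4,|K|)}}`. -/
def cyclotomicSet (F : Type*) {K : Type*} [Field F] [Field K] [Algebra F K]
    (ω : Kˣ) (ℓ : ℤ) (H : Set ℕ) : Set F :=
  {x | 1 + algebraMap F K x * ((ω ^ ℓ : Kˣ) : K) ∈ ⋃ j ∈ H, cyclotomicClass ω 4 j}

/-- The index set `H₀`; the sign `σ` stands for `ε δ`. -/
def indexSet₀ (σ : ℤ) (h : ℕ) : Set ℕ := if σ = 1 then {h, h + 1} else {h + 1, h + 2}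

/-- The index set `H₁`; the sign `σ` stands for `ε δ`. -/
def indexSet₁ (σ : ℤ) (h : ℕ) : Set ℕ := if σ = 1 then {h + 1, h + 2} else {h, h + 1}

/-- The translate `S + s`. -/
def translate {F : Type*} [Add F] (S : Set F) (s : F) : Set F := (fun x => x + s) '' S

/-- The conditions on the pair `(h, ℓ)`: `q + 1 ∤ ℓ`, `χ(ω^ℓ) = i^{3+h}` and
`χ(ω^{ℓq} - ω^ℓ) = i^{δ(1+2h)}`. -/
def IsAdmissible {K : Type*} [Field K] (q : ℕ) (χ : MulChar K ℂ) (ω : Kˣ) (δ : ℤ)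
    (h : ℕ) (ℓ : ℤ) : Prop :=
  ¬ ((q : ℤ) + 1 ∣ ℓ) ∧
  χ ((ω ^ ℓ : Kˣ) : K) = Complex.I ^ (3 + h) ∧
  χ (((ω ^ (ℓ * (q : ℤ)) : Kˣ) : K) - ((ω ^ ℓ : Kˣ) : K)) = Complex.I ^ (δ * (1 + 2 * (h : ℤ)))

end QuarticIntersection

end

/-!
Let `η` be the quadratic character of `F` and write `K = F(θ)` with `θ ^ 2 = g ∈ F` a nonsquare.
Since `q ≡ 1 mod 4`, the quartic character `χ` of `K` restricts to `η` on `F` and is invariant under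
the Frobenius `x ↦ x ^ q`. Everything is expressed by the sums `∑ x : F, χ (1 + x α)` of `χ` along
affine `F`-lines of `K` (`lineSum`).

* Summing over the lines `a + F θ`, on which the trace is constant, gives
  `G(χ) = η(2) G(η) S` with `S = lineSum F χ θ`. As `G(η) ^ 2 = q`, the quotient `G(η) G(χ) / q` is
  `E = η(2) S`, a Gaussian integer of norm `q = m ^ 2 + (m + 1) ^ 2`.
* The symmetry `x ↦ -x` shows that `E` has odd real and even imaginary part. Modulo a prime above
  `p` the character becomes a power map, and `S` is congruent to `± g ^ (2 k) * (3 k).choose (2 k)`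
  with `k = (q - 1) / 4`, which is nonzero by Lucas' theorem
  (`lineSum_sqrt_eq_gaussianInt`). So `p` does not divide `E`, and unique factorization leaves
  only `E = ε m + δ (m + 1) i` (`eq_of_sq_add_sq_eq_prime_pow`).
* For `α ∉ F`, multiplication by `α ^ q` carries the line `1 + F α` to a multiple of `1 + F θ`, hence
  `χ(α) ∑ χ(1 + x α) = χ(α ^ q - α) E` (`quarticChar_mul_lineSum`). Inverting `x - s` turns
  `∑ η(x - s) χ(1 + x α)` into another punctured line sum
  (`quarticChar_mul_sum_quadraticChar_sub`). Finally `∑ χ(1 + x α) ^ 2 = -χ(α) ^ 2`, because `χ ^ 2`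
  is trivial on `F^*`.
* Under the admissibility conditions these sums become, for
  `i ^ (-h) χ(1 + x α) = A(x) + B(x) i`, explicit in `m`, `ε`, `δ` and the value at `s`. The
  indicator functions of the two sets are `(1 ± A + B) / 2`, so all the cardinalities can be read off
  (`intersection_numbers`); the intersection numbers depend on `s` only through `A(s) + B(s) i`.
-/

open Complex QuarticIntersection

/-! ### The quartic character and its restriction to the subfield -/

section Characters

variable {F K : Type*} [Field F] [Field K]

theorem ringChar_ne_two_of_card_mod_four [Fintype F] (hq4 : Fintype.card F % 4 = 1) :
    ringChar F ≠ 2 :=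
  fun h => by have := FiniteField.even_card_of_char_two h; omega

theorem Complex.I_pow_eq_pow_iff (a b : ℕ) : I ^ a = I ^ b ↔ a % 4 = b % 4 := by
  constructor
  · rw [I_pow_eq_pow_mod a, I_pow_eq_pow_mod b]
    have ha := Nat.mod_lt a (show 4 > 0 by norm_num)
    have hb := Nat.mod_lt b (show 4 > 0 by norm_num)
    generalize a % 4 = r at *
    generalize b % 4 = s at *
    interval_cases r <;> interval_cases s <;> simp [Complex.ext_iff, pow_succ] <;> norm_num
  · intro h
    rw [I_pow_eq_pow_mod a, I_pow_eq_pow_mod b, h]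

theorem exists_pow_eq_of_ne_zero [Fintype K] {ω : Kˣ} (hω : Subgroup.zpowers ω = ⊤)
    {x : K} (hx : x ≠ 0) :
    ∃ t : ℕ, t ≤ Fintype.card K - 2 ∧ x = (ω : K) ^ t := by
  have h1 : Units.mk0 x hx ∈ Subgroup.zpowers ω := hω ▸ Subgroup.mem_top _
  have hord : orderOf ω = Fintype.card K - 1 := by
    rw [← Nat.card_zpowers, hω, Subgroup.card_top, Nat.card_units, Nat.card_eq_fintype_card]
  have h0 : 0 < orderOf ω := orderOf_pos ω
  classical
  rw [mem_zpowers_iff_mem_range_orderOf, Finset.mem_image] at h1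
  obtain ⟨t, ht, h⟩ := h1
  rw [Finset.mem_range] at ht
  refine ⟨t, by omega, ?_⟩
  rw [← Units.val_pow_eq_pow_val, h, Units.val_mk0]

theorem card_pred_dvd_of_pow_eq_one [Fintype K] {ω : Kˣ} (hω : Subgroup.zpowers ω = ⊤) {n : ℕ}
    (h : (ω : K) ^ n = 1) : Fintype.card K - 1 ∣ n := by
  have hord : orderOf ω = Fintype.card K - 1 := by
    rw [← Nat.card_zpowers, hω, Subgroup.card_top, Nat.card_units, Nat.card_eq_fintype_card]
  rw [← hord]
  apply orderOf_dvd_of_pow_eq_one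
  ext
  simpa using h

/-- The element `ω ^ ((|K| - 1) / 2)` is `-1`: it is a square root of `1` other than `1`. -/
theorem primitive_pow_half_card [Fintype K] {ω : Kˣ} (hω : Subgroup.zpowers ω = ⊤) {n : ℕ} (hn : 0 < n)
    (h : 2 * n = Fintype.card K - 1) : (ω : K) ^ n = -1 := by
  have h1 : ((ω : K) ^ n) ^ 2 = 1 := by
    rw [← pow_mul, mul_comm, h, FiniteField.pow_card_sub_one_eq_one _ ω.ne_zero]
  rcases eq_or_eq_neg_of_sq_eq_sq _ _ (h1.trans (one_pow 2).symm) with h2 | h2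
  · exact absurd (Nat.le_of_dvd hn (card_pred_dvd_of_pow_eq_one hω h2)) (by omega)
  · exact h2

/-- A nonzero element `a` of the subfield of index two is `ω ^ ((q + 1) j)`; both `χ a` and
the quadratic character of `a` equal `(-1) ^ j`, because `q + 1` is `2` modulo `4`. -/
theorem quarticChar_algebraMap [Fintype F] [DecidableEq F] [Fintype K] [Algebra F K]
    (hK : Fintype.card K = Fintype.card F ^ 2)
    (hq4 : Fintype.card F % 4 = 1) {ω : Kˣ} (hω : Subgroup.zpowers ω = ⊤) {χ : MulChar K ℂ}
    (hχω : χ (ω : K) = I) (a : F) :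
    χ (algebraMap F K a) = (quadraticChar F a : ℂ) := by
  by_cases ha : a = 0
  · rw [ha, map_zero, MulChar.map_zero, MulChar.map_zero, Int.cast_zero]
  obtain ⟨k, hk⟩ : ∃ k, Fintype.card F = 4 * k + 1 := ⟨Fintype.card F / 4, by omega⟩
  have hk0 : 0 < k := by
    rcases Nat.eq_zero_or_pos k with h | h
    · have := Fintype.one_lt_card (α := F); omega
    · exact h
  have hKk : Fintype.card K - 1 = (4 * k) * (4 * k + 2) := by
    rw [hK, hk]; apply Nat.sub_eq_of_eq_add; ring
  obtain ⟨t, -, ht⟩ := exists_pow_eq_of_ne_zero hω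
    ((map_ne_zero_iff _ (algebraMap F K).injective).mpr ha)
  have h1 : (ω : K) ^ (t * (4 * k)) = 1 := by
    rw [pow_mul, ← ht, ← map_pow, show 4 * k = Fintype.card F - 1 by omega,
      FiniteField.pow_card_sub_one_eq_one a ha, map_one]
  obtain ⟨j, hj⟩ : 4 * k + 2 ∣ t := by
    have := card_pred_dvd_of_pow_eq_one hω h1
    rw [hKk, mul_comm t] at this
    exact Nat.dvd_of_mul_dvd_mul_left (by omega) this
  have h2 : χ (algebraMap F K a) = (-1) ^ j := by
    rw [ht, map_pow, hχω, hj, pow_mul]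
    congr 1
    rw [pow_add, pow_mul, I_pow_four, one_pow, one_mul, I_sq]
  have h3 : (algebraMap F K) (a ^ (Fintype.card F / 2)) = (-1) ^ j := by
    rw [map_pow, ht, hj, ← pow_mul, show Fintype.card F / 2 = 2 * k by omega,
      show (4 * k + 2) * j * (2 * k) = ((2 * k) * (4 * k + 2)) * j by ring, pow_mul,
      primitive_pow_half_card hω (by positivity) (by rw [hKk]; ring)]
  have h4 : a ^ (Fintype.card F / 2) = (-1) ^ j := by
    apply (algebraMap F K).injective
    rw [h3]; simp
  rw [h2]
  rw [quadraticChar_eq_pow_of_char_ne_two (ringChar_ne_two_of_card_mod_four hq4) ha, h4]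
  have hne : (-1 : F) ≠ 1 :=
    Ring.neg_one_ne_one_of_char_ne_two (ringChar_ne_two_of_card_mod_four hq4)
  rcases Nat.even_or_odd j with h | h
  · simp [h.neg_one_pow]
  · simp [h.neg_one_pow, hne]

theorem quarticChar_pow_four [Fintype K] {ω : Kˣ} (hω : Subgroup.zpowers ω = ⊤) {χ : MulChar K ℂ}
    (hχω : χ (ω : K) = I) {x : K} (hx : x ≠ 0) : χ x ^ 4 = 1 := by
  obtain ⟨t, -, rfl⟩ := exists_pow_eq_of_ne_zero hω hx
  rw [map_pow, hχω, ← pow_mul, mul_comm, pow_mul, I_pow_four, one_pow]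

/-- An order-four character is invariant under the Frobenius of a subfield of order
congruent to `1` modulo `4`. -/
theorem quarticChar_pow_card [Fintype F] (hq4 : Fintype.card F % 4 = 1) {χ : MulChar K ℂ}
    (hχ4 : ∀ x : K, x ≠ 0 → χ x ^ 4 = 1) (x : K) : χ (x ^ Fintype.card F) = χ x := by
  by_cases hx : x = 0
  · rw [hx, zero_pow Fintype.card_ne_zero]
  · rw [map_pow, ← Nat.div_add_mod (Fintype.card F) 4, hq4, pow_add, pow_mul, hχ4 x hx, one_pow,
      one_mul, pow_one]

/-- The quadratic extension `K` of `F` contains the square root `θ` of a nonsquare `g`, and the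
Frobenius of `F` acts on it by `θ ↦ -θ`. -/
theorem exists_sq_eq_nonsquare [Fintype F] [Fintype K] [Algebra F K]
    (hK : Fintype.card K = Fintype.card F ^ 2)
    (hq4 : Fintype.card F % 4 = 1) :
    ∃ (g : F) (θ : K), ¬ IsSquare g ∧ θ ^ 2 = algebraMap F K g ∧ θ ^ Fintype.card F = -θ := by
  have h2 := ringChar_ne_two_of_card_mod_four hq4
  obtain ⟨g, hg⟩ := FiniteField.exists_nonsquare h2
  have hg0 : g ≠ 0 := fun h => hg (h ▸ IsSquare.zero)
  have hK2 : ringChar K ≠ 2 := fun h => by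
    have := FiniteField.even_card_of_char_two h
    rw [hK, Nat.pow_mod] at this
    have h1 : Fintype.card F % 2 = 1 := by omega
    rw [h1] at this
    omega
  obtain ⟨k, hk⟩ : ∃ k, Fintype.card F = 4 * k + 1 := ⟨Fintype.card F / 4, by omega⟩
  have hKk : Fintype.card K / 2 = (Fintype.card F - 1) * (2 * k + 1) := by
    rw [hK, hk, show (4 * k + 1) ^ 2 = 2 * (4 * k * (2 * k + 1)) + 1 by ring, Nat.add_sub_cancel]
    omega
  have hsq : IsSquare (algebraMap F K g) := by
    rw [FiniteField.isSquare_iff hK2 ((map_ne_zero_iff _ (algebraMap F K).injective).mpr hg0), hKk,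
      pow_mul, ← map_pow, FiniteField.pow_card_sub_one_eq_one g hg0]
    simp
  obtain ⟨θ, hθ⟩ := hsq
  refine ⟨g, θ, hg, by rw [hθ, sq], ?_⟩
  have hgp : g ^ (2 * k) = -1 := by
    have h3 := (FiniteField.pow_dichotomy h2 hg0).resolve_left
      (fun h => hg ((FiniteField.isSquare_iff h2 hg0).mpr h))
    rwa [show Fintype.card F / 2 = 2 * k by omega] at h3
  rw [hk, show 4 * k + 1 = 2 * (2 * k) + 1 by ring, pow_succ, pow_mul, sq, ← hθ, ← map_pow, hgp]
  simp

variable [Algebra F K]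

theorem notMem_range_of_sq_eq_nonsquare {g : F} {θ : K} (hg : ¬ IsSquare g)
    (hθ : θ ^ 2 = algebraMap F K g) : θ ∉ Set.range (algebraMap F K) := by
  rintro ⟨c, rfl⟩
  refine hg ⟨c, (algebraMap F K).injective ?_⟩
  rw [← hθ, map_mul, sq]

theorem add_mul_injective {α : K} (hα : α ∉ Set.range (algebraMap F K)) :
    Function.Injective fun x : F × F => algebraMap F K x.1 + algebraMap F K x.2 * α := by
  rintro ⟨a, b⟩ ⟨c, d⟩ h
  simp only at h
  have hbd : b = d := by
    by_contra hne
    have hne' : algebraMap F K (b - d) ≠ 0 :=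
      (map_ne_zero_iff _ (algebraMap F K).injective).mpr (sub_ne_zero.mpr hne)
    refine hα ⟨(c - a) / (b - d), ?_⟩
    rw [map_div₀, div_eq_iff hne', map_sub, map_sub]
    linear_combination -h
  subst hbd
  simpa using h

theorem add_mul_bijective [Fintype F] [Fintype K] (hK : Fintype.card K = Fintype.card F ^ 2)
    {α : K} (hα : α ∉ Set.range (algebraMap F K)) :
    Function.Bijective fun x : F × F => algebraMap F K x.1 + algebraMap F K x.2 * α :=
  (Fintype.bijective_iff_injective_and_card _).mpr
    ⟨add_mul_injective hα, by rw [Fintype.card_prod, hK, sq]⟩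

theorem one_add_mul_ne_zero {α : K} (hα : α ∉ Set.range (algebraMap F K)) (x : F) :
    1 + algebraMap F K x * α ≠ 0 := by
  intro h
  have := @add_mul_injective F K _ _ _ α hα (1, x) (0, 0) (by simpa using h)
  simp at this

theorem conj_add_mul_sqrt [Fintype F] {θ : K} (hconj : θ ^ Fintype.card F = -θ) (a b : F) :
    (algebraMap F K a + algebraMap F K b * θ) ^ Fintype.card F
      = algebraMap F K a - algebraMap F K b * θ := by
  have := map_add (FiniteField.frobeniusAlgHom F K) (algebraMap F K a) (algebraMap F K b * θ)
  simp only [FiniteField.frobeniusAlgHom_apply] at this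
  rw [this, mul_pow, hconj, ← map_pow, ← map_pow, FiniteField.pow_card, FiniteField.pow_card]
  ring

end Characters

/-! ### Sums of a character along affine lines -/

section LineSums

variable {F K : Type*} [Field F] [Field K]

/-- The sum of the values of `χ` on the affine `F`-line `{1 + x α : x ∈ F}` of `K`. -/
noncomputable def lineSum (F : Type*) {K : Type*} [Field F] [Fintype F] [Field K] [Algebra F K]
    (χ : MulChar K ℂ) (α : K) : ℂ :=
  ∑ x : F, χ (1 + algebraMap F K x * α)

theorem sum_quadraticChar_eq_zero [Fintype F] [DecidableEq F] (h2 : ringChar F ≠ 2) :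
    ∑ x : F, (quadraticChar F x : ℂ) = 0 := by
  have := quadraticChar_sum_zero h2
  exact_mod_cast this

variable [Algebra F K]

theorem sum_add_mul_eq_mul_lineSum [Fintype F] (χ : MulChar K ℂ) {u : K} (hu : u ≠ 0) (v : K) :
    ∑ x : F, χ (u + algebraMap F K x * v) = χ u * lineSum F χ (v / u) := by
  rw [lineSum, Finset.mul_sum]
  refine Finset.sum_congr rfl fun x _ => ?_
  rw [← map_mul]
  congr 1
  field_simp

/-- For `a = 0` both sides vanish; otherwise `a` is factored out of the argument of `χ`. -/
theorem sum_add_mul_sqrt [Fintype F] [DecidableEq F] (h2 : ringChar F ≠ 2) {χ : MulChar K ℂ}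
    (hχF : ∀ a : F, χ (algebraMap F K a) = (quadraticChar F a : ℂ)) (θ : K) (a : F) :
    ∑ b : F, χ (algebraMap F K a + algebraMap F K b * θ)
      = (quadraticChar F a : ℂ) * lineSum F χ θ := by
  by_cases ha : a = 0
  · simp only [ha, map_zero, zero_add, map_mul, hχF, ← Finset.sum_mul,
      sum_quadraticChar_eq_zero h2, zero_mul]
    simp
  · rw [lineSum, Finset.mul_sum]
    symm
    refine Fintype.sum_bijective (fun x => a * x) (mulLeft_bijective₀ a ha) _ _ fun x => ?_
    rw [← hχF, ← map_mul χ, map_mul (algebraMap F K) a x]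
    ring_nf

end LineSums

/-! ### Gauss sums -/

section GaussSums

variable {F K : Type*} [Field F] [Fintype F] [Field K] [Fintype K]

theorem canonicalAddChar_isPrimitive (p : ℕ) [Fact p.Prime] (L : Type*) [Field L] [Finite L]
    [Algebra (ZMod p) L] : (canonicalAddChar p L).IsPrimitive := by
  apply AddChar.IsPrimitive.of_ne_one
  rw [AddChar.ne_one_iff]
  have : FiniteDimensional (ZMod p) L := Module.Finite.of_finite
  obtain ⟨x, hx⟩ := Algebra.trace_surjective (ZMod p) L 1
  refine ⟨x, fun h => ?_⟩
  have h1 : ZMod.stdAddChar (N := p) 1 = ZMod.stdAddChar (N := p) 0 := by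
    rw [AddChar.map_zero_eq_one, ← h, ← hx]
    rfl
  exact one_ne_zero (ZMod.injective_stdAddChar h1)

theorem quadraticCharC_ne_one [DecidableEq F] (h2 : ringChar F ≠ 2) : quadraticCharC F ≠ 1 := by
  obtain ⟨a, ha⟩ := quadraticChar_exists_neg_one' h2
  refine MulChar.ne_one_iff.mpr ⟨a, ?_⟩
  rw [quadraticCharC, MulChar.ringHomComp_apply, ha]
  norm_num

theorem normSq_canonicalGaussSum (p : ℕ) [Fact p.Prime] (L : Type*) [Field L] [Fintype L]
    [Algebra (ZMod p) L] {χ : MulChar L ℂ} (hχ : χ ≠ 1) :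
    normSq (canonicalGaussSum p χ) = Fintype.card L := by
  have h := gaussSum_mul_gaussSum_eq_card hχ (canonicalAddChar_isPrimitive p L)
  have hc : gaussSum χ⁻¹ (canonicalAddChar p L)⁻¹
      = (starRingEnd ℂ) (gaussSum χ (canonicalAddChar p L)) := by
    rw [gaussSum, gaussSum, map_sum]
    refine Finset.sum_congr rfl fun a _ => ?_
    rw [map_mul, ← MulChar.star_apply', AddChar.inv_apply, AddChar.map_neg_eq_conj]
    rfl
  rw [hc, mul_conj] at h
  exact_mod_cast h

theorem normSq_canonicalGaussSum_mul_div [DecidableEq F] (p : ℕ) [Fact p.Prime]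
    [Algebra (ZMod p) F] [Algebra (ZMod p) K] (hK : Fintype.card K = Fintype.card F ^ 2)
    (hq4 : Fintype.card F % 4 = 1) {χ : MulChar K ℂ} (hχ : χ ≠ 1) :
    normSq (canonicalGaussSum p (quadraticCharC F) * canonicalGaussSum p χ / (Fintype.card F : ℂ))
      = Fintype.card F := by
  have hq0 : (Fintype.card F : ℝ) ≠ 0 := Nat.cast_ne_zero.mpr Fintype.card_ne_zero
  rw [map_div₀, map_mul, normSq_canonicalGaussSum p K hχ, normSq_canonicalGaussSum p F
    (quadraticCharC_ne_one (ringChar_ne_two_of_card_mod_four hq4)), hK, normSq_natCast]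
  push_cast
  field_simp

variable [Algebra F K]

theorem trace_add_mul_sqrt (hK : Fintype.card K = Fintype.card F ^ 2) {θ : K}
    (hconj : θ ^ Fintype.card F = -θ) (a b : F) :
    Algebra.trace F K (algebraMap F K a + algebraMap F K b * θ) = 2 * a := by
  have hfr : Module.finrank F K = 2 := by
    have h := Module.card_eq_pow_finrank (K := F) (V := K)
    rw [hK] at h
    exact (Nat.pow_right_injective Fintype.one_lt_card h).symm
  apply (algebraMap F K).injective
  rw [FiniteField.algebraMap_trace_eq_sum_pow, hfr, Finset.sum_range_succ, Finset.sum_range_one,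
    Nat.card_eq_fintype_card, pow_zero, pow_one, pow_one, conj_add_mul_sqrt hconj, map_mul,
    map_ofNat]
  ring

theorem canonicalAddChar_add_mul_sqrt (p : ℕ) [Fact p.Prime] [Algebra (ZMod p) F]
    [Algebra (ZMod p) K] (hK : Fintype.card K = Fintype.card F ^ 2) {θ : K}
    (hconj : θ ^ Fintype.card F = -θ) (a b : F) :
    canonicalAddChar p K (algebraMap F K a + algebraMap F K b * θ)
      = canonicalAddChar p F (2 * a) := by
  have : IsScalarTower (ZMod p) F K := IsScalarTower.of_algebraMap_eq' (RingHom.ext_zmod _ _)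
  have h := Algebra.trace_trace (R := ZMod p) (S := F) (algebraMap F K a + algebraMap F K b * θ)
  rw [trace_add_mul_sqrt hK hconj] at h
  simp only [canonicalAddChar, AddChar.compAddMonoidHom_apply, LinearMap.toAddMonoidHom_coe, h]

/-- Splitting `K` into the lines `a + F θ`, on which the additive character is constant,
factors the quartic Gauss sum over `K` through the quadratic Gauss sum over `F`. -/
theorem canonicalGaussSum_eq_mul_lineSum [DecidableEq F] (p : ℕ) [Fact p.Prime]
    [Algebra (ZMod p) F] [Algebra (ZMod p) K] (hK : Fintype.card K = Fintype.card F ^ 2)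
    (h2 : ringChar F ≠ 2) {χ : MulChar K ℂ}
    (hχF : ∀ a : F, χ (algebraMap F K a) = (quadraticChar F a : ℂ)) {θ : K}
    (hθ : θ ∉ Set.range (algebraMap F K)) (hconj : θ ^ Fintype.card F = -θ) :
    canonicalGaussSum p χ = (quadraticChar F 2 : ℂ) * canonicalGaussSum p (quadraticCharC F) *
      lineSum F χ θ := by
  have h20 : (2 : F) ≠ 0 := Ring.two_ne_zero h2
  have h22 : (quadraticChar F 2 : ℂ) * (quadraticChar F 2 : ℂ) = 1 := by
    rw [← sq]; exact_mod_cast quadraticChar_sq_one h20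
  have hsum : canonicalGaussSum p (quadraticCharC F) =
      ∑ a : F, (quadraticChar F (2 * a) : ℂ) * canonicalAddChar p F (2 * a) := by
    rw [canonicalGaussSum, gaussSum]
    symm
    exact Fintype.sum_bijective (fun x => 2 * x) (mulLeft_bijective₀ (2 : F) h20) _ _ fun x => rfl
  rw [hsum, canonicalGaussSum, gaussSum,
    ← (add_mul_bijective hK hθ).sum_comp, Fintype.sum_prod_type, Finset.mul_sum,
    Finset.sum_mul]
  refine Finset.sum_congr rfl fun a _ => ?_
  simp only [canonicalAddChar_add_mul_sqrt p hK hconj, ← Finset.sum_mul, sum_add_mul_sqrt h2 hχF,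
    map_mul, Int.cast_mul]
  linear_combination (-(quadraticChar F a : ℂ) * canonicalAddChar p F (2 * a) * lineSum F χ θ) * h22

theorem canonicalGaussSum_quadraticCharC_sq [DecidableEq F] (p : ℕ) [Fact p.Prime]
    [Algebra (ZMod p) F] (hq4 : Fintype.card F % 4 = 1) :
    canonicalGaussSum p (quadraticCharC F) ^ 2 = Fintype.card F := by
  have h2 := ringChar_ne_two_of_card_mod_four hq4
  rw [canonicalGaussSum, gaussSum_sq (quadraticCharC_ne_one h2)
    ((quadraticChar_isQuadratic F).comp _) (canonicalAddChar_isPrimitive p F)]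
  rw [quadraticCharC, MulChar.ringHomComp_apply, quadraticChar_neg_one h2,
    ZMod.χ₄_nat_one_mod_four hq4]
  simp

theorem canonicalGaussSum_mul_div [DecidableEq F] (p : ℕ) [Fact p.Prime]
    [Algebra (ZMod p) F] [Algebra (ZMod p) K] (hK : Fintype.card K = Fintype.card F ^ 2)
    (hq4 : Fintype.card F % 4 = 1) {χ : MulChar K ℂ}
    (hχF : ∀ a : F, χ (algebraMap F K a) = (quadraticChar F a : ℂ)) {θ : K}
    (hθ : θ ∉ Set.range (algebraMap F K)) (hconj : θ ^ Fintype.card F = -θ) :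
    canonicalGaussSum p (quadraticCharC F) * canonicalGaussSum p χ / (Fintype.card F : ℂ)
      = (quadraticChar F 2 : ℂ) * lineSum F χ θ := by
  have hq0 : (Fintype.card F : ℂ) ≠ 0 := Nat.cast_ne_zero.mpr Fintype.card_ne_zero
  rw [canonicalGaussSum_eq_mul_lineSum p hK (ringChar_ne_two_of_card_mod_four hq4) hχF hθ hconj,
    div_eq_iff hq0, ← canonicalGaussSum_quadraticCharC_sq p hq4]
  ring

end GaussSums

/-! ### A binomial coefficient and power sums modulo `p` -/

section Nonvanishing

/-- Lucas: in base `p`, the digits of `k = (p ^ f - 1) / 4` all equal `(p - 1) / 4`, so that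
the digits of `2 k` do not exceed those of `3 k`. -/
theorem not_dvd_choose_of_four_mul_add_one {p c : ℕ} [hp : Fact p.Prime] (hc : p = 4 * c + 1)
    (f : ℕ) : ∀ k : ℕ, 4 * k + 1 = p ^ f → ¬ p ∣ (3 * k).choose (2 * k) := by
  induction f with
  | zero =>
    intro k hk
    have : k = 0 := by simpa using hk
    subst this
    simpa using hp.out.ne_one
  | succ f ih =>
    intro k hk
    obtain ⟨r, hr⟩ : ∃ r, 4 * r + 1 = p ^ f := by
      have h1 : p ^ f % 4 = 1 := by
        simp [Nat.pow_mod, show p % 4 = 1 by omega]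
      exact ⟨p ^ f / 4, by omega⟩
    have hkr : k = p * r + c := by
      rw [pow_succ, ← hr] at hk
      subst hc
      nlinarith
    have h3 : 3 * k = 3 * c + p * (3 * r) := by rw [hkr]; ring
    have h2 : 2 * k = 2 * c + p * (2 * r) := by rw [hkr]; ring
    have hmod := Choose.choose_modEq_choose_mod_mul_choose_div_nat (n := 3 * k) (k := 2 * k) (p := p)
    rw [h3, h2, Nat.add_mul_mod_self_left, Nat.add_mul_mod_self_left,
      Nat.add_mul_div_left _ _ hp.out.pos, Nat.add_mul_div_left _ _ hp.out.pos,
      Nat.mod_eq_of_lt (show 3 * c < p by omega), Nat.mod_eq_of_lt (show 2 * c < p by omega),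
      Nat.div_eq_of_lt (show 3 * c < p by omega), Nat.div_eq_of_lt (show 2 * c < p by omega),
      zero_add, zero_add] at hmod
    rw [h3, h2, hmod.dvd_iff dvd_rfl, hp.out.dvd_mul, not_or]
    refine ⟨fun h => ?_, ih r hr⟩
    have h4 : p ∣ (3 * c).factorial := by
      rw [← Nat.choose_mul_factorial_mul_factorial (show 2 * c ≤ 3 * c by omega), mul_assoc]
      exact h.mul_right _
    have := hp.out.dvd_factorial.mp h4
    omega

theorem sum_pow_eq_ite {F : Type*} [Field F] [Fintype F] {i : ℕ} (hi : i ≠ 0) :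
    ∑ x : F, x ^ i = if Fintype.card F - 1 ∣ i then -1 else 0 := by
  classical
  rw [← FiniteField.sum_pow_units F i, ← Finset.sum_subset (Finset.subset_univ {x : F | x ≠ 0})]
  · symm
    refine Finset.sum_bij (fun u _ => (u : F)) (by simp) (fun _ _ _ _ h => Units.ext h) ?_ (by simp)
    intro x hx
    exact ⟨Units.mk0 x (by simpa using hx), Finset.mem_univ _, rfl⟩
  · intro x _ hx
    have : x = 0 := by simpa using hx
    rw [this, zero_pow hi]

/-- Only the exponents `2 j` divisible by `q - 1 = 4 k` contribute, and `4 k` is the only positive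
one among those up to `6 k`. -/
theorem sum_one_add_mul_sq_pow {F : Type*} [Field F] [Fintype F] {k : ℕ}
    (hk : Fintype.card F = 4 * k + 1) (g : F) :
    ∑ x : F, (1 + g * x ^ 2) ^ (3 * k) = -(g ^ (2 * k) * ((3 * k).choose (2 * k) : F)) := by
  have hk0 : 0 < k := by
    have := Fintype.one_lt_card (α := F); omega
  have h1 : ∀ x : F, (1 + g * x ^ 2) ^ (3 * k) =
      ∑ j ∈ Finset.range (3 * k + 1), (g ^ j * ((3 * k).choose j : F)) * x ^ (2 * j) := by
    intro x
    rw [add_comm, add_pow]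
    refine Finset.sum_congr rfl fun j _ => ?_
    rw [one_pow, mul_pow, ← pow_mul]
    ring
  simp only [h1]
  rw [Finset.sum_comm]
  simp only [← Finset.mul_sum]
  rw [Finset.sum_eq_single (2 * k)]
  · rw [sum_pow_eq_ite (by omega), if_pos]
    · ring
    · rw [hk]; exact ⟨1, by omega⟩
  · intro j hj hj2
    rw [Finset.mem_range] at hj
    by_cases hj0 : j = 0
    · subst hj0
      simp
    · rw [sum_pow_eq_ite (by omega), if_neg, mul_zero]
      rw [hk, Nat.add_sub_cancel]
      rintro ⟨d, hd⟩
      have hd1 : d < 2 := by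
        by_contra hcon
        have : 4 * k * 2 ≤ 4 * k * d := Nat.mul_le_mul_left _ (by omega)
        omega
      interval_cases d <;> omega
  · intro h
    exact absurd (Finset.mem_range.mpr (by omega)) h

end Nonvanishing

/-! ### The line sum of a square root as a Gaussian integer -/

section GaussianInteger

/-- Powers of `I` and of another square root `ι` of `-1` have the same integral coordinates. -/
theorem exists_int_pow_eq {R : Type*} [CommRing R] {ι : R} (hι : ι ^ 2 = -1) (t : ℕ) :
    ∃ A B : ℤ, I ^ t = A + B * I ∧ ι ^ t = A + B * ι := by
  induction t with
  | zero => exact ⟨1, 0, by simp, by simp⟩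
  | succ t ih =>
    obtain ⟨A, B, h1, h2⟩ := ih
    refine ⟨-B, A, ?_, ?_⟩
    · rw [pow_succ, h1]; push_cast; linear_combination (B : ℂ) * I_sq
    · rw [pow_succ, h2]; push_cast; linear_combination (B : R) * hι

theorem int_add_mul_I_inj {a b c d : ℤ} (h : (a : ℂ) + b * I = c + d * I) : a = c ∧ b = d := by
  have h1 := congrArg re h
  have h2 := congrArg im h
  simp at h1 h2
  exact ⟨by exact_mod_cast h1, by exact_mod_cast h2⟩

/-- The terms at `x` and `-x` pair up, except at `x = 0`. -/
theorem even_sum_sub_of_neg_invariant {F : Type*} [Field F] [Fintype F] (h2 : ringChar F ≠ 2)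
    {A : F → ℤ} (hA : ∀ x, A (-x) = A x) : Even (∑ x, A x - A 0) := by
  classical
  rw [← Finset.sum_erase_eq_sub (Finset.mem_univ (0 : F)), even_iff_two_dvd]
  refine (ZMod.intCast_zmod_eq_zero_iff_dvd _ 2).mp ?_
  rw [Int.cast_sum]
  refine Finset.sum_involution (fun x _ => -x) ?_ ?_ ?_ ?_
  · intro x _
    rw [hA]
    exact CharTwo.add_self_eq_zero _
  · intro x hx _ h
    exact (Finset.mem_erase.mp hx).1 ((Ring.eq_self_iff_eq_zero_of_char_ne_two h2).mp h)
  · intro x hx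
    simpa using hx
  · intro x _
    exact neg_neg x

variable {F K : Type*} [Field F] [Field K] [Algebra F K]

/-- The line sum of `θ` as a Gaussian integer. Its parities come from the symmetry `x ↦ -x`.
Reducing it modulo a prime above `p` turns the character into a power map,
so that the reduction is a binomial coefficient prime to `p`. -/
theorem lineSum_sqrt_eq_gaussianInt [Fintype F] [Fintype K] (p : ℕ) [Fact p.Prime] [CharP F p]
    (hp4 : p % 4 = 1)
    (hK : Fintype.card K = Fintype.card F ^ 2)
    (hq4 : Fintype.card F % 4 = 1) {ω : Kˣ} (hω : Subgroup.zpowers ω = ⊤) {χ : MulChar K ℂ}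
    (hχω : χ (ω : K) = I) {g : F} {θ : K}
    (hg : ¬ IsSquare g) (hθ : θ ^ 2 = algebraMap F K g) (hconj : θ ^ Fintype.card F = -θ) :
    ∃ u v : ℤ, lineSum F χ θ = u + v * I ∧ Odd u ∧ Even v ∧ ¬ ((p : ℤ) ∣ u ∧ (p : ℤ) ∣ v) := by
  have h2 := ringChar_ne_two_of_card_mod_four hq4
  obtain ⟨k, hk⟩ : ∃ k, Fintype.card F = 4 * k + 1 := ⟨Fintype.card F / 4, by omega⟩
  have hk0 : 0 < k := by
    have := Fintype.one_lt_card (α := F); omega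
  -- `y ↦ y ^ ((q + 1) * 3 k)` reduces `χ` modulo one of the primes of `ℤ[i]` above `p`
  have hι : ((ω : K) ^ ((4 * k + 2) * (3 * k))) ^ 2 = -1 := by
    have hn := primitive_pow_half_card (K := K) hω (n := (4 * k + 2) * (2 * k)) (by positivity)
      (by rw [hK, hk]; symm; apply Nat.sub_eq_of_eq_add; ring)
    rw [← pow_mul, show (4 * k + 2) * (3 * k) * 2 = (4 * k + 2) * (2 * k) * 3 by ring, pow_mul, hn]
    ring
  have hrep : ∀ x : F, ∃ A B : ℤ, χ (1 + algebraMap F K x * θ) = A + B * I ∧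
      (1 + algebraMap F K x * θ) ^ ((4 * k + 2) * (3 * k)) =
        A + B * (ω : K) ^ ((4 * k + 2) * (3 * k)) := by
    intro x
    obtain ⟨t, -, ht⟩ := exists_pow_eq_of_ne_zero hω
      (one_add_mul_ne_zero (notMem_range_of_sq_eq_nonsquare hg hθ) x)
    obtain ⟨A, B, h1, h3⟩ := exists_int_pow_eq hι t
    refine ⟨A, B, ?_, ?_⟩
    · rw [ht, map_pow, hχω, h1]
    · rw [ht, ← h3, ← pow_mul, ← pow_mul, mul_comm]
  choose A B hAB hpow using hrep
  have hneg : ∀ x, A (-x) = A x ∧ B (-x) = B x := by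
    intro x
    apply int_add_mul_I_inj
    rw [← hAB, ← hAB, ← quarticChar_pow_card hq4 (fun y hy => quarticChar_pow_four hω hχω hy)
      (1 + algebraMap F K x * θ)]
    have := conj_add_mul_sqrt hconj 1 x
    rw [map_one] at this
    rw [this, map_neg, neg_mul, sub_eq_add_neg]
  have h0 : A 0 = 1 ∧ B 0 = 0 := by
    apply int_add_mul_I_inj
    rw [← hAB]
    simp
  refine ⟨∑ x, A x, ∑ x, B x, ?_, ?_, ?_, ?_⟩
  · simp only [lineSum, hAB, Finset.sum_add_distrib, Finset.sum_mul, Int.cast_sum]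
  · have := even_sum_sub_of_neg_invariant h2 fun x => (hneg x).1
    rw [h0.1] at this
    simpa using this.add_one
  · have := even_sum_sub_of_neg_invariant h2 fun x => (hneg x).2
    rwa [h0.2, sub_zero] at this
  · rintro ⟨hu, hv⟩
    have : CharP K p := charP_of_injective_algebraMap (algebraMap F K).injective p
    have hu' : ((∑ x, A x : ℤ) : K) = 0 := (CharP.intCast_eq_zero_iff K p _).mpr hu
    have hv' : ((∑ x, B x : ℤ) : K) = 0 := (CharP.intCast_eq_zero_iff K p _).mpr hv
    have hsum : ∑ x : F, (1 + algebraMap F K x * θ) ^ ((4 * k + 2) * (3 * k)) = 0 := by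
      simp only [hpow, Finset.sum_add_distrib, ← Finset.sum_mul]
      rw [← Int.cast_sum, ← Int.cast_sum, hu', hv']
      ring
    have hnorm : ∀ x : F, (1 + algebraMap F K x * θ) ^ ((4 * k + 2) * (3 * k)) =
        algebraMap F K ((1 + (-g) * x ^ 2) ^ (3 * k)) := by
      intro x
      have hc := conj_add_mul_sqrt hconj 1 x
      rw [map_one] at hc
      rw [pow_mul, show 4 * k + 2 = Fintype.card F + 1 by omega, pow_succ, hc, map_pow]
      congr 1
      simp only [map_add, map_mul, map_neg, map_pow, map_one, ← hθ]
      ring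
    simp only [hnorm, ← map_sum] at hsum
    rw [map_eq_zero_iff _ (algebraMap F K).injective, sum_one_add_mul_sq_pow hk, neg_eq_zero,
      mul_eq_zero] at hsum
    rcases hsum with h | h
    · have hg0 : g ≠ 0 := fun h => hg (h ▸ IsSquare.zero)
      exact pow_ne_zero _ (neg_ne_zero.mpr hg0) h
    · rw [CharP.cast_eq_zero_iff F p] at h
      obtain ⟨f, -, hf⟩ := FiniteField.card F p
      exact not_dvd_choose_of_four_mul_add_one (c := p / 4) (by omega) f k (hk ▸ hf) h

end GaussianInteger

/-! ### Primitive representations of a prime power as a sum of two squares -/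

section TwoSquares

/-- A representation `2 m² + 2 m + 1 = u² + v²` by coprime `u` odd and `v` even is the obvious one,
if the number is a prime power: the prime divides only one of `u (m + 1) ± v m`. -/
theorem eq_of_sq_add_sq_eq_prime_pow {p f m : ℕ} (hp : p.Prime) (hp2 : p ≠ 2) (hm : Odd m)
    (hf : p ^ f = 2 * m ^ 2 + 2 * m + 1) {u v : ℤ} (huv : u ^ 2 + v ^ 2 = (p : ℤ) ^ f)
    (hu : Odd u) (hv : Even v) (hnd : ¬ ((p : ℤ) ∣ u ∧ (p : ℤ) ∣ v)) :
    (u = m ∨ u = -m) ∧ (v = m + 1 ∨ v = -(m + 1)) := by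
  have hpI : Prime (p : ℤ) := Nat.prime_iff_prime_int.mp hp
  have hm0 : 0 < m := hm.pos
  have hq : ((p : ℤ) ^ f) = 2 * (m : ℤ) ^ 2 + 2 * m + 1 := by exact_mod_cast hf
  have hf0 : f ≠ 0 := by
    rintro rfl
    simp at hf
    omega
  have hpq : (p : ℤ) ∣ 2 * (m : ℤ) ^ 2 + 2 * m + 1 := hq ▸ dvd_pow_self _ hf0
  -- the case in which `p ^ f` divides `u (m + 1) - w m`, where `w` is `v` or `-v`
  have key : ∀ w : ℤ, u ^ 2 + w ^ 2 = (p : ℤ) ^ f → Even w →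
      (p : ℤ) ^ f ∣ u * (m + 1) - w * m → u * (m + 1) = w * m := by
    intro w hw hwe hdvd
    obtain ⟨c, hc⟩ := hdvd
    have hqpos : (0 : ℤ) < (p : ℤ) ^ f := by rw [hq]; positivity
    have hid : (u * m + w * (m + 1)) ^ 2 + ((p : ℤ) ^ f * c) ^ 2 = ((p : ℤ) ^ f) ^ 2 := by
      rw [← hc]
      have : ((p : ℤ) ^ f) ^ 2 = (u ^ 2 + w ^ 2) * (2 * (m : ℤ) ^ 2 + 2 * m + 1) := by
        rw [hw, ← hq, sq]
      rw [this]; ring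
    by_cases hc0 : c = 0
    · rw [hc0, mul_zero] at hc
      linarith
    · exfalso
      have hc1 : 1 ≤ c ^ 2 := one_le_sq_iff_one_le_abs c |>.mpr (Int.one_le_abs hc0)
      have hz : u * m + w * (m + 1) = 0 := by
        have h1 : (u * m + w * (m + 1)) ^ 2 ≤ 0 := by
          have : ((p : ℤ) ^ f) ^ 2 * 1 ≤ ((p : ℤ) ^ f) ^ 2 * c ^ 2 :=
            mul_le_mul_of_nonneg_left hc1 (sq_nonneg _)
          nlinarith
        exact pow_eq_zero_iff (two_ne_zero) |>.mp (le_antisymm h1 (sq_nonneg _))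
      have hmo : Odd (m : ℤ) := by exact_mod_cast hm
      have h3 : Odd (u * m + w * (m + 1)) := (hu.mul hmo).add_even (hwe.mul_right _)
      rw [hz] at h3
      exact absurd h3 (by decide)
  have hfin : ∀ w : ℤ, u ^ 2 + w ^ 2 = (p : ℤ) ^ f → u * (m + 1) = w * m →
      (u = m ∨ u = -m) ∧ (w = m + 1 ∨ w = -(m + 1)) := by
    intro w hw h
    have hm1 : (0 : ℤ) < m := by exact_mod_cast hm0
    have h1 : (u - m) * (u + m) * (2 * (m : ℤ) ^ 2 + 2 * m + 1) = 0 := by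
      have e1 : u ^ 2 * (m + 1) ^ 2 = w ^ 2 * (m : ℤ) ^ 2 := by rw [← mul_pow, h, mul_pow]
      rw [hq] at hw
      linear_combination e1 + (m : ℤ) ^ 2 * hw
    have h2 : (2 * (m : ℤ) ^ 2 + 2 * m + 1) ≠ 0 := by positivity
    rcases mul_eq_zero.mp ((mul_eq_zero.mp h1).resolve_right h2) with h3 | h3
    · have hu' : u = m := by linarith
      refine ⟨Or.inl hu', Or.inl ?_⟩
      rw [hu', mul_comm] at h
      exact (mul_right_cancel₀ hm1.ne' h).symm
    · have hu' : u = -m := by linarith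
      refine ⟨Or.inr hu', Or.inr ?_⟩
      rw [hu'] at h
      apply mul_right_cancel₀ hm1.ne'
      rw [← h]; ring
  have hnot : ¬ ((p : ℤ) ∣ u * (m + 1) - v * m ∧ (p : ℤ) ∣ u * (m + 1) + v * m) := by
    rintro ⟨h1, h2⟩
    have h2' : ¬ (p : ℤ) ∣ 2 := fun h => hp2 ((Nat.prime_dvd_prime_iff_eq hp Nat.prime_two).mp
      (by exact_mod_cast h))
    have hnm : ¬ (p : ℤ) ∣ m := fun h => hpI.not_dvd_one (by
      have : (p : ℤ) ∣ 2 * (m : ℤ) ^ 2 + 2 * m := by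
        have : 2 * (m : ℤ) ^ 2 + 2 * m = m * (2 * m + 2) := by ring
        rw [this]; exact h.mul_right _
      exact (Int.dvd_add_right this).mp hpq)
    have hnm1 : ¬ (p : ℤ) ∣ m + 1 := fun h => hpI.not_dvd_one (by
      have : (p : ℤ) ∣ 2 * (m : ℤ) ^ 2 + 2 * m := by
        have : 2 * (m : ℤ) ^ 2 + 2 * m = (m + 1) * (2 * m) := by ring
        rw [this]; exact h.mul_right _
      exact (Int.dvd_add_right this).mp hpq)
    have e1 : (p : ℤ) ∣ 2 * (u * (m + 1)) := by
      have := dvd_add h1 h2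
      ring_nf at this ⊢; exact this
    have e2 : (p : ℤ) ∣ 2 * (v * m) := by
      have := dvd_sub h2 h1
      ring_nf at this ⊢; exact this
    exact hnd ⟨((hpI.dvd_or_dvd e1).resolve_left h2' |> hpI.dvd_or_dvd).resolve_right hnm1,
      ((hpI.dvd_or_dvd e2).resolve_left h2' |> hpI.dvd_or_dvd).resolve_right hnm⟩
  have hprod : (p : ℤ) ^ f ∣ (u * (m + 1) - v * m) * (u * (m + 1) + v * m) := by
    refine ⟨u ^ 2 - m ^ 2, ?_⟩
    have h1 : (u * (m + 1) - v * m) * (u * (m + 1) + v * m) =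
      u ^ 2 * (2 * (m : ℤ) ^ 2 + 2 * m + 1) - (u ^ 2 + v ^ 2) * m ^ 2 := by ring
    rw [h1, huv, ← hq]; ring
  by_cases h1 : (p : ℤ) ∣ u * (m + 1) - v * m
  · have h2 : ¬ (p : ℤ) ∣ u * (m + 1) + v * m := fun h => hnot ⟨h1, h⟩
    have h3 := hpI.pow_dvd_of_dvd_mul_right f h2 hprod
    exact hfin v huv (key v huv hv h3)
  · have h3 := hpI.pow_dvd_of_dvd_mul_left f h1 hprod
    have hw : u ^ 2 + (-v) ^ 2 = (p : ℤ) ^ f := by rw [neg_sq, huv]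
    have h4 := hfin (-v) hw (key (-v) hw hv.neg (by rwa [neg_mul, sub_neg_eq_add]))
    exact ⟨h4.1, h4.2.symm.imp (fun h => by linarith) (fun h => by linarith)⟩

/-- `-1` is the square of `(m + 1) / m` modulo `p`. -/
theorem prime_mod_four_of_dvd {p m : ℕ} [hp : Fact p.Prime] (h : p ∣ 2 * m ^ 2 + 2 * m + 1) :
    p % 4 = 1 := by
  have hz : (2 * (m : ZMod p) ^ 2 + 2 * m + 1) = 0 := by
    have := (ZMod.natCast_eq_zero_iff _ _).mpr h
    exact_mod_cast this
  have hm0 : (m : ZMod p) ≠ 0 := by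
    intro h0
    rw [h0] at hz
    simp at hz
  have h3 : p % 4 ≠ 3 := ZMod.mod_four_ne_three_of_sq_eq_neg_one (y := ((m : ZMod p) + 1) / m) (by
    rw [div_pow, div_eq_iff (pow_ne_zero 2 hm0)]
    linear_combination hz)
  have h2 : p ≠ 2 := by
    rintro rfl
    omega
  have := hp.out.odd_of_ne_two h2
  rw [Nat.odd_iff] at this
  omega

end TwoSquares

/-! ### Evaluation of line sums -/

section LineEvaluation

variable {F K : Type*} [Field F] [Fintype F] [DecidableEq F] [Field K] [Algebra F K]

/-- Multiplication by the conjugate of `α` maps the line `1 + F α` onto a multiple of the line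
`1 + F θ`, so all the line sums are determined by the one of `θ`. -/
theorem quarticChar_mul_lineSum [Fintype K] (hK : Fintype.card K = Fintype.card F ^ 2)
    (hq4 : Fintype.card F % 4 = 1) {χ : MulChar K ℂ}
    (hχ4 : ∀ x : K, x ≠ 0 → χ x ^ 4 = 1)
    (hχF : ∀ a : F, χ (algebraMap F K a) = (quadraticChar F a : ℂ)) {g : F} {θ : K}
    (hg : ¬ IsSquare g) (hθ : θ ^ 2 = algebraMap F K g) (hconj : θ ^ Fintype.card F = -θ)
    {α : K} (hα : α ∉ Set.range (algebraMap F K)) :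
    χ α * lineSum F χ α =
      χ (α ^ Fintype.card F - α) * ((quadraticChar F 2 : ℂ) * lineSum F χ θ) := by
  have h2 := ringChar_ne_two_of_card_mod_four hq4
  have h20 : (2 : F) ≠ 0 := Ring.two_ne_zero h2
  have h22 : (quadraticChar F 2 : ℂ) * (quadraticChar F 2 : ℂ) = 1 := by
    rw [← sq]; exact_mod_cast quadraticChar_sq_one h20
  have hg0 : g ≠ 0 := fun h => hg (h ▸ IsSquare.zero)
  obtain ⟨⟨a, b⟩, hab⟩ :=
    (add_mul_bijective hK (notMem_range_of_sq_eq_nonsquare hg hθ)).2 α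
  simp only at hab
  have hb : b ≠ 0 := by
    rintro rfl
    exact hα ⟨a, by simpa using hab⟩
  have hαq : α ^ Fintype.card F = algebraMap F K a - algebraMap F K b * θ := by
    rw [← hab, conj_add_mul_sqrt hconj]
  have hnorm : a ^ 2 - g * b ^ 2 ≠ 0 := by
    intro h
    refine hg ⟨a / b, ?_⟩
    field_simp
    linear_combination -h
  have hd : χ (α ^ Fintype.card F - α) * (quadraticChar F 2 : ℂ) =
      χ (-(algebraMap F K b * θ)) := by
    have : α ^ Fintype.card F - α = algebraMap F K 2 * (-(algebraMap F K b * θ)) := by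
      rw [hαq, ← hab, map_ofNat]; ring
    rw [this, map_mul, hχF]
    linear_combination χ (-(algebraMap F K b * θ)) * h22
  rw [← mul_assoc, hd, ← quarticChar_pow_card hq4 hχ4 α, hαq, lineSum, lineSum, Finset.mul_sum,
    Finset.mul_sum]
  have hbij : Function.Bijective fun x : F => -(a + x * (a ^ 2 - g * b ^ 2)) / (b * g) := by
    rw [← Finite.injective_iff_bijective]
    intro x y hxy
    have hbg : b * g ≠ 0 := mul_ne_zero hb hg0
    simp only [div_left_inj' hbg, neg_inj, add_right_inj] at hxy
    exact mul_right_cancel₀ hnorm hxy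
  refine Fintype.sum_bijective _ hbij _ _ fun x => ?_
  rw [← map_mul, ← map_mul]
  congr 1
  have hb' : algebraMap F K b ≠ 0 := (map_ne_zero_iff _ (algebraMap F K).injective).mpr hb
  have hg' : algebraMap F K g ≠ 0 := (map_ne_zero_iff _ (algebraMap F K).injective).mpr hg0
  rw [← hab]
  simp only [map_div₀, map_neg, map_add, map_sub, map_mul, map_pow]
  field_simp
  linear_combination (-algebraMap F K a - algebraMap F K x * algebraMap F K a ^ 2) * hθ

/-- The sum of `η (x - s) χ (1 + x α)`. Since `χ` restricts to `η` on `F`, the substitution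
`x - s = 1 / w` turns it into a sum of `χ` along another line, punctured at one point. -/
theorem quarticChar_mul_sum_quadraticChar_sub [Fintype K]
    (hK : Fintype.card K = Fintype.card F ^ 2)
    (hq4 : Fintype.card F % 4 = 1) {χ : MulChar K ℂ}
    (hχ4 : ∀ x : K, x ≠ 0 → χ x ^ 4 = 1)
    (hχF : ∀ a : F, χ (algebraMap F K a) = (quadraticChar F a : ℂ)) {g : F} {θ : K}
    (hg : ¬ IsSquare g) (hθ : θ ^ 2 = algebraMap F K g) (hconj : θ ^ Fintype.card F = -θ)
    {α : K} (hα : α ∉ Set.range (algebraMap F K)) (s : F) :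
    χ (1 + algebraMap F K s * α) *
      (∑ x : F, (quadraticChar F (x - s) : ℂ) * χ (1 + algebraMap F K x * α) + χ α) =
      χ (α ^ Fintype.card F - α) * ((quadraticChar F 2 : ℂ) * lineSum F χ θ) := by
  have hα0 : α ≠ 0 := by
    rintro rfl
    exact hα ⟨0, map_zero _⟩
  set a : K := 1 + algebraMap F K s * α with ha
  have ha0 : a ≠ 0 := one_add_mul_ne_zero hα s
  have hsum : ∑ x : F, (quadraticChar F (x - s) : ℂ) * χ (1 + algebraMap F K x * α) + χ α =
      χ α * lineSum F χ (a / α) := by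
    rw [← sum_add_mul_eq_mul_lineSum χ hα0 a, ← eq_sub_iff_add_eq]
    have hterm : ∀ w : F, χ (α + algebraMap F K w * a) - (if w = 0 then χ α else 0) =
        (quadraticChar F w⁻¹ : ℂ) * χ (a + algebraMap F K w⁻¹ * α) := by
      intro w
      by_cases hw : w = 0
      · simp [hw]
      · have hw' : algebraMap F K w ≠ 0 := (map_ne_zero_iff _ (algebraMap F K).injective).mpr hw
        have hsq : (quadraticChar F w⁻¹ : ℂ) * (quadraticChar F w⁻¹ : ℂ) = 1 := by
          rw [← sq]; exact_mod_cast quadraticChar_sq_one (inv_ne_zero hw)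
        have : a + algebraMap F K w⁻¹ * α = algebraMap F K w⁻¹ * (α + algebraMap F K w * a) := by
          rw [map_inv₀]; field_simp; ring
        rw [if_neg hw, sub_zero, this, map_mul, hχF, ← mul_assoc, hsq, one_mul]
    have h1 : ∑ w : F, (χ (α + algebraMap F K w * a) - (if w = 0 then χ α else 0)) =
        ∑ x : F, χ (α + algebraMap F K x * a) - χ α := by
      rw [Finset.sum_sub_distrib]
      simp
    rw [← h1]
    simp only [hterm]
    symm
    refine Fintype.sum_bijective (fun w : F => w⁻¹ + s)
      ((Equiv.addRight s).bijective.comp inv_involutive.bijective) _ _ fun w => ?_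
    rw [add_sub_cancel_right, map_add (algebraMap F K), ha]
    ring_nf
  have hnotin : a / α ∉ Set.range (algebraMap F K) := by
    rintro ⟨c, hc⟩
    rw [eq_div_iff hα0, ha] at hc
    have : algebraMap F K (c - s) * α = 1 := by rw [map_sub]; linear_combination hc
    refine hα ⟨(c - s)⁻¹, ?_⟩
    rw [map_inv₀, eq_comm]
    exact eq_inv_of_mul_eq_one_right this
  have hline := quarticChar_mul_lineSum hK hq4 hχ4 hχF hg hθ hconj hnotin
  have haq : a ^ Fintype.card F = 1 + algebraMap F K s * α ^ Fintype.card F := by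
    have := map_add (FiniteField.frobeniusAlgHom F K) 1 (algebraMap F K s * α)
    simp only [FiniteField.frobeniusAlgHom_apply] at this
    rw [ha, this, one_pow, mul_pow, ← map_pow, FiniteField.pow_card]
  have hαq0 : α ^ Fintype.card F ≠ 0 := pow_ne_zero _ hα0
  have hdiff : ((a / α) ^ Fintype.card F - a / α) * (α ^ Fintype.card F * α) =
      algebraMap F K (-1) * (α ^ Fintype.card F - α) := by
    rw [div_pow, haq, ha, map_neg, map_one]
    field_simp
    ring
  have hχd : χ ((a / α) ^ Fintype.card F - a / α) * (χ α * χ α) =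
      χ (α ^ Fintype.card F - α) := by
    have h1 := congrArg χ hdiff
    rw [map_mul, map_mul, quarticChar_pow_card hq4 hχ4, map_mul, hχF,
      quadraticChar_neg_one (ringChar_ne_two_of_card_mod_four hq4),
      ZMod.χ₄_nat_one_mod_four hq4, Int.cast_one, one_mul] at h1
    exact h1
  have haα : χ (a / α) * χ α = χ a := by rw [← map_mul, div_mul_cancel₀ _ hα0]
  rw [hsum, ← hχd, ← haα]
  linear_combination χ α * χ α * hline

/-- The nonzero elements of `K` are partitioned into the lines `F^* (1 + x α)` and `F^* α`
through the origin, and `χ ^ 2` is trivial on `F^*`. -/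
theorem sum_quarticChar_sq [Fintype K] (hK : Fintype.card K = Fintype.card F ^ 2)
    {χ : MulChar K ℂ}
    (hχF : ∀ a : F, χ (algebraMap F K a) = (quadraticChar F a : ℂ)) (hχ2 : χ ^ 2 ≠ 1)
    {α : K} (hα : α ∉ Set.range (algebraMap F K)) :
    ∑ x : F, χ (1 + algebraMap F K x * α) ^ 2 = -χ α ^ 2 := by
  have hη : ∀ a : F, a ≠ 0 → (quadraticChar F a : ℂ) ^ 2 = 1 := fun a ha => by
    exact_mod_cast quadraticChar_sq_one ha
  have h0 : ∑ y : K, χ y ^ 2 = 0 := by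
    rw [← MulChar.sum_eq_zero_of_ne_one hχ2]
    exact Finset.sum_congr rfl fun y _ => (MulChar.pow_apply' χ two_ne_zero y).symm
  set L := ∑ x : F, χ (1 + algebraMap F K x * α) ^ 2 with hL
  rw [← (add_mul_bijective hK hα).sum_comp, Fintype.sum_prod_type] at h0
  have hline : ∀ a : F, ∑ b : F, χ (algebraMap F K a + algebraMap F K b * α) ^ 2 =
      L + if a = 0 then ((Fintype.card F : ℂ) - 1) * χ α ^ 2 - L else 0 := by
    intro a
    by_cases ha : a = 0
    · rw [if_pos ha, add_sub_cancel, ha]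
      have hterm : ∀ b : F, χ (algebraMap F K 0 + algebraMap F K b * α) ^ 2 =
          χ α ^ 2 - if b = 0 then χ α ^ 2 else 0 := by
        intro b
        by_cases hb : b = 0
        · simp [hb, MulChar.map_zero]
        · rw [map_zero, zero_add, map_mul, hχF, mul_pow, hη b hb, if_neg hb, one_mul, sub_zero]
      simp only [hterm, Finset.sum_sub_distrib]
      simp
      ring
    · rw [if_neg ha, add_zero, hL]
      symm
      refine Fintype.sum_bijective (fun x => a * x) (mulLeft_bijective₀ a ha) _ _ fun x => ?_
      have : algebraMap F K a + algebraMap F K (a * x) * α =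
          algebraMap F K a * (1 + algebraMap F K x * α) := by
        rw [map_mul]; ring
      rw [this, map_mul, hχF, mul_pow, hη a ha, one_mul]
  simp only [hline, Finset.sum_add_distrib] at h0
  simp only [Finset.sum_const, Finset.card_univ, nsmul_eq_mul, Finset.sum_ite_eq', Finset.mem_univ,
    if_true] at h0
  have hq1 : (Fintype.card F : ℂ) - 1 ≠ 0 := by
    have h1 : (Fintype.card F : ℂ) ≠ 1 := by exact_mod_cast (Fintype.one_lt_card (α := F)).ne'
    exact sub_ne_zero.mpr h1
  apply mul_left_cancel₀ hq1
  linear_combination h0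

end LineEvaluation

/-! ### Cyclotomic classes and admissible pairs -/

section Cyclotomy

variable {F K : Type*} [Field F] [Field K]

theorem mem_cyclotomicClass_four_iff [Fintype K] {ω : Kˣ} (hω : Subgroup.zpowers ω = ⊤)
    {χ : MulChar K ℂ} (hχω : χ (ω : K) = I) {y : K} (hy : y ≠ 0) (j : ℕ) :
    y ∈ cyclotomicClass ω 4 j ↔ χ y = I ^ j := by
  constructor
  · rintro ⟨u, hu, rfl⟩
    obtain ⟨n, rfl⟩ := (mem_powers_iff_mem_zpowers.mpr hu)
    simp [hχω, I_pow_four]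
  · obtain ⟨t, -, rfl⟩ := exists_pow_eq_of_ne_zero hω hy
    rw [map_pow, hχω, Complex.I_pow_eq_pow_iff]
    intro h
    obtain ⟨c, hc⟩ : (4 : ℤ) ∣ (t : ℤ) - j := by omega
    refine ⟨(ω ^ 4) ^ c, ⟨c, rfl⟩, ?_⟩
    rw [← Units.val_pow_eq_pow_val]
    congr 1
    rw [← zpow_natCast, ← zpow_natCast, ← zpow_natCast, ← zpow_mul, ← zpow_add]
    congr 1
    push_cast
    omega

theorem mem_cyclotomicClass_two_zero_iff [Fintype F] [DecidableEq F] {γ : Fˣ}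
    (hγ : Subgroup.zpowers γ = ⊤) (x : F) :
    x ∈ cyclotomicClass γ 2 0 ↔ quadraticChar F x = 1 := by
  constructor
  · rintro ⟨u, ⟨n, rfl⟩, rfl⟩
    rw [quadraticChar_one_iff_isSquare (Units.ne_zero _)]
    refine ⟨((γ ^ n : Fˣ) : F), ?_⟩
    rw [← Units.val_mul]
    congr 1
    rw [pow_zero, one_mul]
    change (γ ^ 2) ^ n = _
    rw [← zpow_natCast, ← zpow_mul, ← zpow_add]
    congr 1
    push_cast
    ring
  · intro h
    have hx : x ≠ 0 := by
      rintro rfl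
      simp at h
    obtain ⟨b, rfl⟩ := (quadraticChar_one_iff_isSquare hx).mp h
    have hb : b ≠ 0 := left_ne_zero_of_mul hx
    obtain ⟨n, -, rfl⟩ := exists_pow_eq_of_ne_zero hγ hb
    refine ⟨(γ ^ 2) ^ n, ⟨n, by simp⟩, ?_⟩
    simp only [pow_zero, one_mul, Units.val_pow_eq_pow_val]
    ring

variable [Algebra F K]

theorem mem_cyclotomicSet_iff [Fintype K] {ω : Kˣ} (hω : Subgroup.zpowers ω = ⊤)
    {χ : MulChar K ℂ} (hχω : χ (ω : K) = I) {ℓ : ℤ}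
    (hα : ((ω ^ ℓ : Kˣ) : K) ∉ Set.range (algebraMap F K)) (H : Set ℕ) (x : F) :
    x ∈ cyclotomicSet F ω ℓ H ↔
      ∃ j ∈ H, χ (1 + algebraMap F K x * ((ω ^ ℓ : Kˣ) : K)) = I ^ j := by
  simp only [cyclotomicSet, Set.mem_ofPred_eq, Set.mem_iUnion, exists_prop,
    mem_cyclotomicClass_four_iff hω hχω (one_add_mul_ne_zero hα x)]

/-- If `ω ^ ℓ` lies in `F` then `ω ^ (ℓ (q - 1)) = 1`, so that `q + 1` divides `ℓ`. -/
theorem zpow_notMem_range [Fintype F] [Fintype K] (hK : Fintype.card K = Fintype.card F ^ 2)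
    {ω : Kˣ} (hω : Subgroup.zpowers ω = ⊤) {ℓ : ℤ} (hℓ : ¬ (Fintype.card F : ℤ) + 1 ∣ ℓ) :
    ((ω ^ ℓ : Kˣ) : K) ∉ Set.range (algebraMap F K) := by
  rintro ⟨c, hc⟩
  have hq1 := Fintype.one_lt_card (α := F)
  have hc0 : c ≠ 0 := by
    rintro rfl
    rw [map_zero] at hc
    exact (ω ^ ℓ).ne_zero hc.symm
  have hord : orderOf ω = Fintype.card K - 1 := by
    rw [← Nat.card_zpowers, hω, Subgroup.card_top, Nat.card_units, Nat.card_eq_fintype_card]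
  have h1 : ω ^ (ℓ * ((Fintype.card F - 1 : ℕ) : ℤ)) = 1 := by
    ext
    rw [zpow_mul, zpow_natCast, Units.val_pow_eq_pow_val, ← hc, ← map_pow,
      FiniteField.pow_card_sub_one_eq_one c hc0, map_one, Units.val_one]
  have h2 := orderOf_dvd_iff_zpow_eq_one.mpr h1
  have h3 : Fintype.card K - 1 = (Fintype.card F + 1) * (Fintype.card F - 1) := by
    rw [hK, ← Nat.sq_sub_sq, one_pow]
  rw [hord, h3, Nat.cast_mul] at h2
  have h4 : ((Fintype.card F - 1 : ℕ) : ℤ) ≠ 0 := by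
    have : Fintype.card F - 1 ≠ 0 := by omega
    exact_mod_cast this
  have h5 := Int.dvd_of_mul_dvd_mul_right h4 h2
  exact hℓ (by exact_mod_cast h5)

/-- The pair is found among `ω ^ ℓ = c θ` with `c ∈ F`: rescaling by a nonsquare of `F` changes the
sign of `χ (ω ^ (ℓ q) - ω ^ ℓ)`, while `h` remains even. -/
theorem exists_isAdmissible [Fintype F] [DecidableEq F] [Fintype K]
    (hK : Fintype.card K = Fintype.card F ^ 2)
    (hq4 : Fintype.card F % 4 = 1) {ω : Kˣ} (hω : Subgroup.zpowers ω = ⊤) {χ : MulChar K ℂ}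
    (hχF : ∀ a : F, χ (algebraMap F K a) = (quadraticChar F a : ℂ)) {g : F} {θ : K}
    (hg : ¬ IsSquare g) (hθ : θ ^ 2 = algebraMap F K g) (hconj : θ ^ Fintype.card F = -θ)
    {δ : ℤ} (hδ : δ = 1 ∨ δ = -1) :
    ∃ h ℓ : ℕ, h ≤ 3 ∧ ℓ ≤ Fintype.card F ^ 2 - 2 ∧
      IsAdmissible (Fintype.card F) χ ω δ h ℓ := by
  have h2 := ringChar_ne_two_of_card_mod_four hq4
  have h20 : (2 : F) ≠ 0 := Ring.two_ne_zero h2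
  have hg0 : g ≠ 0 := fun h => hg (h ▸ IsSquare.zero)
  have hθ0 : θ ≠ 0 := by
    rintro rfl
    rw [zero_pow two_ne_zero, eq_comm, map_eq_zero_iff _ (algebraMap F K).injective] at hθ
    exact hg0 hθ
  have hηg : quadraticChar F g = -1 := quadraticChar_neg_one_iff_not_isSquare.mpr hg
  have hχθ : χ θ = I ∨ χ θ = -I := by
    apply sq_eq_sq_iff_eq_or_eq_neg.mp
    rw [← map_pow, hθ, hχF, hηg, I_sq]
    norm_num
  have hη2 : quadraticChar F (-2) = 1 ∨ quadraticChar F (-2) = -1 :=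
    quadraticChar_dichotomy (neg_ne_zero.mpr h20)
  -- the scalar `c` is chosen such that `χ (-2 c θ) = δ i`
  obtain ⟨c, hc0, hc, hcd⟩ : ∃ c : F, c ≠ 0 ∧ (χ (algebraMap F K c * θ) = I ∨
      χ (algebraMap F K c * θ) = -I) ∧ χ (algebraMap F K (-2) * (algebraMap F K c * θ)) = δ * I := by
    have hη1 : quadraticChar F 1 = 1 := map_one _
    simp only [map_mul, hχF]
    rcases hχθ with h | h <;> rcases hη2 with h' | h' <;> rcases hδ with rfl | rfl
    all_goals first
      | (refine ⟨1, one_ne_zero, by simp [h], ?_⟩; rw [h, h', hη1]; simp; done)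
      | (refine ⟨g, hg0, by rw [h, hηg]; simp, ?_⟩; rw [h, h', hηg]; simp)
  set α := algebraMap F K c * θ with hα
  have hα0 : α ≠ 0 := mul_ne_zero ((map_ne_zero_iff _ (algebraMap F K).injective).mpr hc0) hθ0
  have hαq : α ^ Fintype.card F = -α := by
    rw [hα, mul_pow, hconj, ← map_pow, FiniteField.pow_card, mul_neg]
  obtain ⟨ℓ, hℓ, hαℓ⟩ := exists_pow_eq_of_ne_zero hω hα0
  have hval : ((ω ^ (ℓ : ℤ) : Kˣ) : K) = α := by rw [zpow_natCast, Units.val_pow_eq_pow_val, hαℓ]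
  have hvalq : ((ω ^ ((ℓ : ℤ) * (Fintype.card F : ℤ)) : Kˣ) : K) = -α := by
    rw [zpow_mul, zpow_natCast, Units.val_pow_eq_pow_val, hval, hαq]
  have hnd : ¬ ((Fintype.card F : ℤ) + 1 ∣ ℓ) := by
    intro hdvd
    obtain ⟨j, rfl⟩ : Fintype.card F + 1 ∣ ℓ := by exact_mod_cast hdvd
    have hq1 := Fintype.one_lt_card (α := F)
    have h1 : α ^ (Fintype.card F - 1) = 1 := by
      have h3 : Fintype.card K - 1 = (Fintype.card F + 1) * (Fintype.card F - 1) := by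
        rw [hK, ← Nat.sq_sub_sq, one_pow]
      rw [hαℓ, ← pow_mul, mul_right_comm, ← h3, pow_mul,
        FiniteField.pow_card_sub_one_eq_one _ ω.ne_zero, one_pow]
    have h3 : α ^ Fintype.card F = α := by
      conv_lhs => rw [show Fintype.card F = Fintype.card F - 1 + 1 by omega]
      rw [pow_succ, h1, one_mul]
    have h4 : (2 : K) * α = 0 := by
      rw [hαq] at h3
      linear_combination -h3
    have h5 : (2 : K) ≠ 0 := by
      rw [← map_ofNat (algebraMap F K)]
      exact (map_ne_zero_iff _ (algebraMap F K).injective).mpr h20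
    exact (mul_ne_zero h5 hα0) h4
  have hdiff : χ (-α - α) = δ * I := by
    rw [← hcd]
    congr 1
    rw [map_neg, map_ofNat]
    ring
  have hzpow : ∀ n : ℤ, I ^ (4 * n) = 1 := fun n => by
    rw [zpow_mul]
    have : I ^ (4 : ℤ) = 1 := by exact_mod_cast I_pow_four
    rw [this, one_zpow]
  have hIδ : ∀ n : ℤ, I ^ (δ * (1 + 4 * n)) = δ * I := by
    intro n
    rw [show δ * (1 + 4 * n) = δ + 4 * (δ * n) by ring, zpow_add₀ I_ne_zero, hzpow, mul_one]
    rcases hδ with rfl | rfl <;> simp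
  rw [← hK]
  rcases hc with hc | hc
  · refine ⟨2, ℓ, by norm_num, hℓ, hnd, ?_, ?_⟩
    · rw [hval, hc, show 3 + 2 = 4 + 1 by norm_num, pow_add, I_pow_four, one_mul, pow_one]
    · rw [hvalq, hval, hdiff]
      have := hIδ 1
      norm_num at this ⊢
      exact this.symm
  · refine ⟨0, ℓ, by norm_num, hℓ, hnd, ?_, ?_⟩
    · rw [hval, hc, add_zero, I_pow_three]
    · rw [hvalq, hval, hdiff]
      have := hIδ 0
      norm_num at this ⊢
      exact this.symm

end Cyclotomy

/-! ### Intersection numbers -/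

section Counting


theorem ncard_eq_sum_indicator {F : Type*} [Fintype F] (S : Set F) [DecidablePred (· ∈ S)] :
    (S.ncard : ℤ) = ∑ x : F, if x ∈ S then 1 else 0 := by
  rw [Set.ncard_eq_toFinset_card', Finset.sum_boole, Set.toFinset]
  congr 2
  ext x; simp

theorem mem_translate_iff {F : Type*} [AddGroup F] (S : Set F) (s x : F) :
    x ∈ translate S s ↔ x - s ∈ S := by
  constructor
  · rintro ⟨y, hy, rfl⟩
    simpa using hy
  · intro h
    exact ⟨x - s, h, by simp⟩

theorem int_cases_of_sq_add_sq_eq_one {a b : ℤ} (h : a ^ 2 + b ^ 2 = 1) :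
    (a = 1 ∧ b = 0) ∨ (a = -1 ∧ b = 0) ∨ (a = 0 ∧ b = 1) ∨ (a = 0 ∧ b = -1) := by
  have ha : a ≤ 1 := by nlinarith [sq_nonneg b]
  have ha' : -1 ≤ a := by nlinarith [sq_nonneg b]
  have hb : b ≤ 1 := by nlinarith [sq_nonneg a]
  have hb' : -1 ≤ b := by nlinarith [sq_nonneg a]
  interval_cases a <;> interval_cases b <;> simp_all

theorem exists_eq_of_sum_pos {F : Type*} [Fintype F] {f : F → ℤ} (h : 0 < ∑ x, f x) :
    ∃ x, 0 < f x := by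
  by_contra! hcon
  exact (Finset.sum_nonpos fun x _ => hcon x).not_gt h

/-- The counting part of the argument. The function `A + B i` takes the four values `±1, ±i`;
its sums, plain and twisted by the quadratic character, give the intersection numbers of the sets
`{A + B = 1}` and `{B - A = 1}` with the translates of the squares. -/
theorem intersection_numbers {F : Type*} [Field F] [Fintype F] [DecidableEq F] {m : ℕ}
    (hm : Odd m) (h2 : ringChar F ≠ 2) (hq : (Fintype.card F : ℤ) = 2 * m ^ 2 + 2 * m + 1)
    {A B : F → ℤ} (hAB : ∀ x, A x ^ 2 + B x ^ 2 = 1)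
    (hA : ∑ x, A x = -m) (hB : ∑ x, B x = -(m + 1)) (hsq : ∑ x, (A x ^ 2 - B x ^ 2) = 1)
    (hηA : ∀ s, ∑ x, quadraticChar F (x - s) * A x = m * B s - (m + 1) * A s)
    (hηB : ∀ s, ∑ x, quadraticChar F (x - s) * B x = m * A s + (m + 1) * B s + 1)
    {D₀ D₁ C : Set F} (hD₀ : ∀ x, x ∈ D₀ ↔ A x + B x = 1) (hD₁ : ∀ x, x ∈ D₁ ↔ B x - A x = 1)
    (hC : ∀ x, x ∈ C ↔ quadraticChar F x = 1) :
    D₀.ncard = m ^ 2 ∧ D₁.ncard = m ^ 2 + m ∧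
    {n : ℤ | ∃ s : F, n = (D₀ ∩ translate (C ∪ {0}) s).ncard + (D₁ ∩ translate C s).ncard} =
      {(m : ℤ) ^ 2, (m : ℤ) ^ 2 + m + 1} ∧
    {n : ℤ | ∃ s : F, n =
        (D₀ ∩ translate C s).ncard + (D₁ ∩ translate ({x | x ≠ 0} \ C) s).ncard} =
      {(m : ℤ) ^ 2 - 1, (m : ℤ) ^ 2, (m : ℤ) ^ 2 + m - 1, (m : ℤ) ^ 2 + m} := by
  classical
  have hm1 : (1 : ℤ) ≤ m := by exact_mod_cast hm.pos
  have hcases := fun x => int_cases_of_sq_add_sq_eq_one (hAB x)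
  have hone : ∑ _x : F, (1 : ℤ) = 2 * m ^ 2 + 2 * m + 1 := by simp [hq]
  have hη0 : ∀ s : F, ∑ x : F, quadraticChar F (x - s) = 0 := fun s => by
    rw [← quadraticChar_sum_zero h2]
    exact (Equiv.subRight s).sum_comp fun x => quadraticChar F x
  have hδ : ∀ (s : F) (f : F → ℤ), ∑ x : F, (if x = s then f x else 0) = f s := by
    intro s f; simp
  have hi₀ : ∀ x, 2 * (if x ∈ D₀ then 1 else 0) = 1 + A x + B x := by
    intro x
    rw [if_congr (hD₀ x) rfl rfl]
    rcases hcases x with ⟨h, h'⟩ | ⟨h, h'⟩ | ⟨h, h'⟩ | ⟨h, h'⟩ <;> simp [h, h']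
  have hi₁ : ∀ x, 2 * (if x ∈ D₁ then 1 else 0) = 1 - A x + B x := by
    intro x
    rw [if_congr (hD₁ x) rfl rfl]
    rcases hcases x with ⟨h, h'⟩ | ⟨h, h'⟩ | ⟨h, h'⟩ | ⟨h, h'⟩ <;> simp [h, h']
  have hη : ∀ x : F, (x = 0 ∧ quadraticChar F x = 0) ∨ (x ≠ 0 ∧ quadraticChar F x = 1) ∨
      (x ≠ 0 ∧ quadraticChar F x = -1) := by
    intro x
    by_cases hx : x = 0
    · exact Or.inl ⟨hx, by simp [hx]⟩
    · exact Or.inr ((quadraticChar_dichotomy hx).imp (⟨hx, ·⟩) (⟨hx, ·⟩))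
  -- twice the indicator functions of the translates of `C ∪ {0}`, `C` and the nonsquares
  have hj₀ : ∀ s x, 2 * (if x ∈ translate (C ∪ {0}) s then 1 else 0) =
      1 + quadraticChar F (x - s) + if x = s then 1 else 0 := by
    intro s x
    simp only [mem_translate_iff, Set.mem_union, hC, Set.mem_singleton_iff, ← sub_eq_zero (a := x)]
    rcases hη (x - s) with ⟨h, h'⟩ | ⟨h, h'⟩ | ⟨h, h'⟩ <;> simp [h, h']
  have hj₁ : ∀ s x, 2 * (if x ∈ translate C s then 1 else 0) =
      1 + quadraticChar F (x - s) - if x = s then 1 else 0 := by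
    intro s x
    simp only [mem_translate_iff, hC, ← sub_eq_zero (a := x)]
    rcases hη (x - s) with ⟨h, h'⟩ | ⟨h, h'⟩ | ⟨h, h'⟩ <;> simp [h, h']
  have hj₂ : ∀ s x, 2 * (if x ∈ translate ({x | x ≠ 0} \ C) s then 1 else 0) =
      1 - quadraticChar F (x - s) - if x = s then 1 else 0 := by
    intro s x
    simp only [mem_translate_iff, Set.mem_sdiff, Set.mem_ofPred_eq, hC, ← sub_eq_zero (a := x)]
    rcases hη (x - s) with ⟨h, h'⟩ | ⟨h, h'⟩ | ⟨h, h'⟩ <;> simp [h, h']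
  have hinter : ∀ (S T : Set F) (x : F), (if x ∈ S ∩ T then (1 : ℤ) else 0) =
      (if x ∈ S then 1 else 0) * (if x ∈ T then 1 else 0) := by
    intro S T x
    by_cases h : x ∈ S <;> by_cases h' : x ∈ T <;> simp [h, h']
  have hcard₀ : (D₀.ncard : ℤ) = m ^ 2 := by
    have : 2 * (D₀.ncard : ℤ) = 2 * m ^ 2 := by
      rw [ncard_eq_sum_indicator, Finset.mul_sum]
      simp only [hi₀, Finset.sum_add_distrib, hone, hA, hB]
      ring
    linarith
  have hcard₁ : (D₁.ncard : ℤ) = m ^ 2 + m := by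
    have : 2 * (D₁.ncard : ℤ) = 2 * (m ^ 2 + m) := by
      rw [ncard_eq_sum_indicator, Finset.mul_sum]
      simp only [hi₁, Finset.sum_add_distrib, Finset.sum_sub_distrib, hone, hA, hB]
      ring
    linarith
  have hN : ∀ s : F, 2 * (((D₀ ∩ translate (C ∪ {0}) s).ncard : ℤ) + (D₁ ∩ translate C s).ncard) =
      2 * m ^ 2 + m + 1 + (m + 1) * (A s + B s) := by
    intro s
    have h4 : 4 * (((D₀ ∩ translate (C ∪ {0}) s).ncard : ℤ) + (D₁ ∩ translate C s).ncard) =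
        ∑ x : F, (2 * 1 + 2 * B x + 2 * quadraticChar F (x - s) + 2 * (quadraticChar F (x - s) * B x)
          + 2 * (if x = s then A x else 0)) := by
      rw [ncard_eq_sum_indicator, ncard_eq_sum_indicator, ← Finset.sum_add_distrib, Finset.mul_sum]
      refine Finset.sum_congr rfl fun x _ => ?_
      rw [hinter, hinter]
      have e : (if x = s then A x else 0) = A x * (if x = s then 1 else 0) := by simp
      rw [e]
      linear_combination (2 * if x ∈ translate (C ∪ {0}) s then (1 : ℤ) else 0) * hi₀ x +
        (1 + A x + B x) * hj₀ s x + (2 * if x ∈ translate C s then (1 : ℤ) else 0) * hi₁ x +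
        (1 - A x + B x) * hj₁ s x
    simp only [Finset.sum_add_distrib, ← Finset.mul_sum, hone, hB, hη0, hηB, hδ] at h4
    linarith
  have hM : ∀ s : F, 2 * (((D₀ ∩ translate C s).ncard : ℤ) +
      (D₁ ∩ translate ({x | x ≠ 0} \ C) s).ncard) =
      2 * m ^ 2 + m - 1 - B s + m * B s - (m + 1) * A s := by
    intro s
    have h4 : 4 * (((D₀ ∩ translate C s).ncard : ℤ) +
        (D₁ ∩ translate ({x | x ≠ 0} \ C) s).ncard) =
        ∑ x : F, (2 * 1 + 2 * B x + 2 * (quadraticChar F (x - s) * A x)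
          - 2 * (if x = s then 1 + B x else 0)) := by
      rw [ncard_eq_sum_indicator, ncard_eq_sum_indicator, ← Finset.sum_add_distrib, Finset.mul_sum]
      refine Finset.sum_congr rfl fun x _ => ?_
      rw [hinter, hinter]
      have e : (if x = s then 1 + B x else 0) = (1 + B x) * (if x = s then 1 else 0) := by simp
      rw [e]
      linear_combination (2 * if x ∈ translate C s then (1 : ℤ) else 0) * hi₀ x +
        (1 + A x + B x) * hj₁ s x +
        (2 * if x ∈ translate ({x | x ≠ 0} \ C) s then (1 : ℤ) else 0) * hi₁ x +
        (1 - A x + B x) * hj₂ s x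
    simp only [Finset.sum_add_distrib, Finset.sum_sub_distrib, ← Finset.mul_sum, hone, hB, hηA,
      hδ] at h4
    linarith
  -- the sizes of the level sets of `A + B i`
  have hA2 : 2 * ∑ x, A x ^ 2 = 2 * (m ^ 2 + m + 1) := by
    have h1 : ∑ x, (A x ^ 2 + B x ^ 2) = 2 * m ^ 2 + 2 * m + 1 := by simp only [hAB, hone]
    rw [Finset.sum_add_distrib] at h1
    rw [Finset.sum_sub_distrib] at hsq
    linarith
  have hB2 : 2 * ∑ x, B x ^ 2 = 2 * (m ^ 2 + m) := by
    rw [Finset.sum_sub_distrib] at hsq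
    linarith
  have hexA : ∃ x, A x = 1 ∧ B x = 0 := by
    obtain ⟨x, hx⟩ := exists_eq_of_sum_pos (f := fun x => A x ^ 2 + A x)
      (by rw [Finset.sum_add_distrib, hA]; nlinarith)
    refine ⟨x, ?_⟩
    rcases hcases x with ⟨h, h'⟩ | ⟨h, h'⟩ | ⟨h, h'⟩ | ⟨h, h'⟩ <;> simp [h, h'] at hx ⊢
  have hexA' : ∃ x, A x = -1 ∧ B x = 0 := by
    obtain ⟨x, hx⟩ := exists_eq_of_sum_pos (f := fun x => A x ^ 2 - A x)
      (by rw [Finset.sum_sub_distrib, hA]; nlinarith)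
    refine ⟨x, ?_⟩
    rcases hcases x with ⟨h, h'⟩ | ⟨h, h'⟩ | ⟨h, h'⟩ | ⟨h, h'⟩ <;> simp [h, h'] at hx ⊢
  have hexB' : ∃ x, A x = 0 ∧ B x = -1 := by
    obtain ⟨x, hx⟩ := exists_eq_of_sum_pos (f := fun x => B x ^ 2 - B x)
      (by rw [Finset.sum_sub_distrib, hB]; nlinarith)
    refine ⟨x, ?_⟩
    rcases hcases x with ⟨h, h'⟩ | ⟨h, h'⟩ | ⟨h, h'⟩ | ⟨h, h'⟩ <;> simp [h, h'] at hx ⊢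
  have hexB : (m : ℤ) ≠ 1 → ∃ x, A x = 0 ∧ B x = 1 := by
    intro hne
    have hm2 : (2 : ℤ) ≤ m := by omega
    obtain ⟨x, hx⟩ := exists_eq_of_sum_pos (f := fun x => B x ^ 2 + B x)
      (by rw [Finset.sum_add_distrib, hB]; nlinarith)
    refine ⟨x, ?_⟩
    rcases hcases x with ⟨h, h'⟩ | ⟨h, h'⟩ | ⟨h, h'⟩ | ⟨h, h'⟩ <;> simp [h, h'] at hx ⊢
  refine ⟨by exact_mod_cast hcard₀, by exact_mod_cast hcard₁, ?_, ?_⟩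
  · ext n
    simp only [Set.mem_ofPred_eq, Set.mem_insert_iff, Set.mem_singleton_iff]
    constructor
    · rintro ⟨s, rfl⟩
      have := hN s
      rcases hcases s with ⟨h, h'⟩ | ⟨h, h'⟩ | ⟨h, h'⟩ | ⟨h, h'⟩ <;> rw [h, h'] at this
      · right; linarith
      · left; linarith
      · right; linarith
      · left; linarith
    · rintro (rfl | rfl)
      · obtain ⟨s, h, h'⟩ := hexA'
        have := hN s
        rw [h, h'] at this
        exact ⟨s, by linarith⟩
      · obtain ⟨s, h, h'⟩ := hexA
        have := hN s
        rw [h, h'] at this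
        exact ⟨s, by linarith⟩
  · ext n
    simp only [Set.mem_ofPred_eq, Set.mem_insert_iff, Set.mem_singleton_iff]
    constructor
    · rintro ⟨s, rfl⟩
      have := hM s
      rcases hcases s with ⟨h, h'⟩ | ⟨h, h'⟩ | ⟨h, h'⟩ | ⟨h, h'⟩ <;> rw [h, h'] at this
      · left; linarith
      · right; right; right; linarith
      · right; right; left; linarith
      · right; left; linarith
    · have hsq' : ∃ s : F, (m : ℤ) ^ 2 = ((D₀ ∩ translate C s).ncard : ℤ) +
          (D₁ ∩ translate ({x | x ≠ 0} \ C) s).ncard := by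
        obtain ⟨s, h, h'⟩ := hexB'
        have := hM s
        rw [h, h'] at this
        exact ⟨s, by linarith⟩
      rintro (rfl | rfl | rfl | rfl)
      · obtain ⟨s, h, h'⟩ := hexA
        have := hM s
        rw [h, h'] at this
        exact ⟨s, by linarith⟩
      · exact hsq'
      · -- for `m = 1` the level set `A + B i = i` is empty, but then `m ^ 2 + m - 1 = m ^ 2`
        by_cases hm' : (m : ℤ) = 1
        · rwa [hm', show (1 : ℤ) ^ 2 + 1 - 1 = (m : ℤ) ^ 2 by rw [hm']; norm_num]
        · obtain ⟨s, h, h'⟩ := hexB hm'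
          have := hM s
          rw [h, h'] at this
          exact ⟨s, by linarith⟩
      · obtain ⟨s, h, h'⟩ := hexA'
        have := hM s
        rw [h, h'] at this
        exact ⟨s, by linarith⟩

end Counting

/-! ### Fourth roots of unity -/

section FourthRoots

theorem exists_int_of_pow_four_eq_one {z : ℂ} (hz : z ^ 4 = 1) :
    ∃ A B : ℤ, z = A + B * I ∧ A ^ 2 + B ^ 2 = 1 := by
  have h : (z - 1) * (z + 1) * ((z - I) * (z + I)) = 0 := by
    linear_combination hz - (z ^ 2 - 1) * I_sq
  rcases mul_eq_zero.mp h with h | h <;> rcases mul_eq_zero.mp h with h | h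
  · exact ⟨1, 0, by push_cast; linear_combination h, by norm_num⟩
  · exact ⟨-1, 0, by push_cast; linear_combination h, by norm_num⟩
  · exact ⟨0, 1, by push_cast; linear_combination h, by norm_num⟩
  · exact ⟨0, -1, by push_cast; linear_combination h, by norm_num⟩

theorem int_add_eq_one_iff {A B : ℤ} (h : A ^ 2 + B ^ 2 = 1) :
    A + B = 1 ↔ (A + B * I : ℂ) = 1 ∨ (A + B * I : ℂ) = I := by
  rcases int_cases_of_sq_add_sq_eq_one h with ⟨rfl, rfl⟩ | ⟨rfl, rfl⟩ | ⟨rfl, rfl⟩ | ⟨rfl, rfl⟩ <;>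
    norm_num [Complex.ext_iff]

theorem int_sub_eq_one_iff {A B : ℤ} (h : A ^ 2 + B ^ 2 = 1) :
    B - A = 1 ↔ (A + B * I : ℂ) = I ∨ (A + B * I : ℂ) = -1 := by
  rcases int_cases_of_sq_add_sq_eq_one h with ⟨rfl, rfl⟩ | ⟨rfl, rfl⟩ | ⟨rfl, rfl⟩ | ⟨rfl, rfl⟩ <;>
    norm_num [Complex.ext_iff]

theorem I_zpow_sign_mul {δ : ℤ} (hδ : δ = 1 ∨ δ = -1) (h : ℕ) :
    I ^ (δ * (1 + 2 * (h : ℤ))) = δ * I * (I ^ h) ^ 2 := by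
  have h4 : (I ^ h) ^ 2 * (I ^ h) ^ 2 = 1 := by
    rw [← pow_add, ← pow_mul, mul_comm, pow_mul, I_pow_four, one_pow]
  have h1 : I ^ (1 + 2 * (h : ℤ)) = I * (I ^ h) ^ 2 := by
    rw [zpow_add₀ I_ne_zero, zpow_one, mul_comm (2 : ℤ), zpow_mul, zpow_natCast]
    norm_cast
  rcases hδ with rfl | rfl
  · rw [one_mul, h1]; push_cast; ring
  · rw [neg_one_mul, zpow_neg, h1]
    refine inv_eq_of_mul_eq_one_right ?_
    push_cast
    linear_combination -(I ^ 2) * h4 - I_sq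

end FourthRoots

/-! ### Conclusion -/

theorem theorem5p3
    (m q p : ℕ) [Fact p.Prime] (hm : Odd m) (hq : q = 2 * m ^ 2 + 2 * m + 1)
    (F K : Type*) [Field F] [Fintype F] [DecidableEq F] [Field K] [Fintype K]
    [Algebra F K] [Algebra (ZMod p) F] [Algebra (ZMod p) K]
    (hF : Fintype.card F = q) (hK : Fintype.card K = q ^ 2)
    -- `γ` and `ω` are primitive elements of `F` and `K`
    (γ : Fˣ) (hγ : Subgroup.zpowers γ = ⊤) (ω : Kˣ) (hω : Subgroup.zpowers ω = ⊤)
    (χ : MulChar K ℂ) (hχ : orderOf χ = 4) (hχω : χ (ω : K) = Complex.I) :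
    ∃ ε δ : ℤ, (ε = 1 ∨ ε = -1) ∧ (δ = 1 ∨ δ = -1) ∧
      QuarticIntersection.canonicalGaussSum p (QuarticIntersection.quadraticCharC F) *
          QuarticIntersection.canonicalGaussSum p χ / (q : ℂ) =
        (ε : ℂ) * m + (δ : ℂ) * (m + 1) * Complex.I ∧
      -- suitable `h` and `ℓ` exist
      (∃ h ℓ : ℕ, h ≤ 3 ∧ ℓ ≤ q ^ 2 - 2 ∧ QuarticIntersection.IsAdmissible q χ ω δ h ℓ) ∧
      -- and for all of them the conclusions hold
      ∀ (h : ℕ) (ℓ : ℤ), h ≤ 3 → QuarticIntersection.IsAdmissible q χ ω δ h ℓ →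
        ∀ D₀ D₁ C : Set F,
          D₀ = QuarticIntersection.cyclotomicSet F ω ℓ
            (QuarticIntersection.indexSet₀ (ε * δ) h) →
          D₁ = QuarticIntersection.cyclotomicSet F ω ℓ
            (QuarticIntersection.indexSet₁ (ε * δ) h) →
          C = QuarticIntersection.cyclotomicClass γ 2 0 →
          D₀.ncard = m ^ 2 ∧ D₁.ncard = m ^ 2 + m ∧
          {n : ℤ | ∃ s : F, n =
              (D₀ ∩ QuarticIntersection.translate (C ∪ {0}) s).ncard +
              (D₁ ∩ QuarticIntersection.translate C s).ncard} =
            {(m : ℤ) ^ 2, (m : ℤ) ^ 2 + m + 1} ∧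
          {n : ℤ | ∃ s : F, n =
              (D₀ ∩ QuarticIntersection.translate C s).ncard +
              (D₁ ∩ QuarticIntersection.translate ({x | x ≠ 0} \ C) s).ncard} =
            {(m : ℤ) ^ 2 - 1, (m : ℤ) ^ 2, (m : ℤ) ^ 2 + m - 1, (m : ℤ) ^ 2 + m} := by
  subst hF
  have hq4 : Fintype.card F % 4 = 1 := by
    obtain ⟨n, rfl⟩ := hm
    rw [hq]
    have : 2 * (2 * n + 1) ^ 2 + 2 * (2 * n + 1) + 1 = 4 * (2 * n ^ 2 + 3 * n + 1) + 1 := by ring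
    omega
  have h2 := ringChar_ne_two_of_card_mod_four hq4
  have h20 : (2 : F) ≠ 0 := Ring.two_ne_zero h2
  have hCharP : CharP F p := charP_of_injective_algebraMap (algebraMap (ZMod p) F).injective p
  obtain ⟨f, hp, hf⟩ := FiniteField.card F p
  have hp4 : p % 4 = 1 := prime_mod_four_of_dvd (m := m) (by
    rw [← hq, hf]; exact dvd_pow_self p f.ne_zero)
  have hχF := quarticChar_algebraMap hK hq4 hω hχω
  have hχ4 : ∀ x : K, x ≠ 0 → χ x ^ 4 = 1 := fun x hx => quarticChar_pow_four hω hχω hx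
  have hχ1 : χ ≠ 1 := by
    rintro rfl
    simp at hχ
  have hχ2 : χ ^ 2 ≠ 1 := fun h => by
    have := orderOf_dvd_of_pow_eq_one h
    rw [hχ] at this
    norm_num at this
  obtain ⟨g, θ, hg, hθ, hconj⟩ := exists_sq_eq_nonsquare hK hq4
  obtain ⟨u, v, huv, hu, hv, hnd⟩ := lineSum_sqrt_eq_gaussianInt p hp4 hK hq4 hω hχω hg hθ hconj
  have hE := canonicalGaussSum_mul_div p hK hq4 hχF (notMem_range_of_sq_eq_nonsquare hg hθ) hconj
  have hnorm := normSq_canonicalGaussSum_mul_div p hK hq4 hχ1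
  have hη2 := quadraticChar_sq_one h20
  have huv2 : u ^ 2 + v ^ 2 = (p : ℤ) ^ (f : ℕ) := by
    have h4 : ((p : ℤ) ^ (f : ℕ)) = (Fintype.card F : ℤ) := by rw [hf]; push_cast; rfl
    rw [h4]
    have h6 : normSq ((u : ℂ) + v * I) = (u : ℝ) ^ 2 + (v : ℝ) ^ 2 := by
      have := normSq_add_mul_I (u : ℝ) (v : ℝ)
      exact_mod_cast this
    rw [hE, huv, map_mul, h6, normSq_intCast, ← sq] at hnorm
    have h5 : (((quadraticChar F 2) : ℤ) : ℝ) ^ 2 = 1 := by exact_mod_cast hη2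
    rw [h5, one_mul] at hnorm
    exact_mod_cast hnorm
  obtain ⟨hu', hv'⟩ := eq_of_sq_add_sq_eq_prime_pow hp (by omega) hm (hf ▸ hq) huv2 hu hv hnd
  obtain ⟨ε, δ, hε, hδ, hεδ⟩ : ∃ ε δ : ℤ, (ε = 1 ∨ ε = -1) ∧ (δ = 1 ∨ δ = -1) ∧
      (quadraticChar F 2 : ℂ) * lineSum F χ θ = (ε : ℂ) * m + (δ : ℂ) * (m + 1) * I := by
    rw [huv]
    obtain ⟨ε, hε, rfl⟩ : ∃ ε : ℤ, (ε = 1 ∨ ε = -1) ∧ u = ε * m :=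
      hu'.elim (fun h => ⟨1, Or.inl rfl, by rw [h]; ring⟩) fun h => ⟨-1, Or.inr rfl, by rw [h]; ring⟩
    obtain ⟨δ, hδ, rfl⟩ : ∃ δ : ℤ, (δ = 1 ∨ δ = -1) ∧ v = δ * (m + 1) :=
      hv'.elim (fun h => ⟨1, Or.inl rfl, by rw [h]; ring⟩) fun h => ⟨-1, Or.inr rfl, by rw [h]; ring⟩
    rcases quadraticChar_dichotomy h20 with h | h
    · exact ⟨ε, δ, hε, hδ, by rw [h]; push_cast; ring⟩
    · refine ⟨-ε, -δ, ?_, ?_, by rw [h]; push_cast; ring⟩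
      · rcases hε with rfl | rfl <;> simp
      · rcases hδ with rfl | rfl <;> simp
  refine ⟨ε, δ, hε, hδ, hE.trans hεδ,
    exists_isAdmissible hK hq4 hω hχF hg hθ hconj hδ, ?_⟩
  rintro h ℓ - ⟨hℓ, hχα, hχd⟩ D₀ D₁ C rfl rfl rfl
  have hα := zpow_notMem_range hK hω hℓ
  have hD := fun H x => mem_cyclotomicSet_iff hω hχω hα H x
  have hαq : ((ω ^ (ℓ * (Fintype.card F : ℤ)) : Kˣ) : K) =
      ((ω ^ ℓ : Kˣ) : K) ^ Fintype.card F := by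
    rw [zpow_mul, zpow_natCast, Units.val_pow_eq_pow_val]
  rw [hαq, I_zpow_sign_mul hδ] at hχd
  set α : K := ((ω ^ ℓ : Kˣ) : K) with hαdef
  have hline := quarticChar_mul_lineSum hK hq4 hχ4 hχF hg hθ hconj hα
  have htwist := quarticChar_mul_sum_quadraticChar_sub hK hq4 hχ4 hχF hg hθ hconj hα
  have hsqsum := sum_quarticChar_sq hK hχF hχ2 hα
  rw [hεδ, hχd, hχα, pow_add, I_pow_three] at hline
  simp only [hεδ, hχd, hχα, pow_add, I_pow_three] at htwist
  rw [hχα, pow_add, I_pow_three] at hsqsum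
  set z : ℂ := I ^ h with hz
  have hz4 : z ^ 4 = 1 := by rw [hz, ← pow_mul, mul_comm, pow_mul, I_pow_four, one_pow]
  have hz0 : z ≠ 0 := pow_ne_zero _ I_ne_zero
  -- the normalized values `i ^ (-h) χ (1 + x α)`
  have hw4 : ∀ x : F, (z ^ 3 * χ (1 + algebraMap F K x * α)) ^ 4 = 1 := fun x => by
    rw [mul_pow, hχ4 _ (one_add_mul_ne_zero hα x), ← pow_mul, mul_comm 3 4, pow_mul, hz4, one_pow,
      one_mul]
  choose A B hAB hAB1 using fun x => exists_int_of_pow_four_eq_one (hw4 x)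
  have hχAB : ∀ x : F, χ (1 + algebraMap F K x * α) = z * (A x + B x * I) := fun x => by
    rw [← hAB]
    linear_combination (-χ (1 + algebraMap F K x * α)) * hz4
  have hABc : ∀ x : F, ((A x : ℂ) ^ 2 + (B x : ℂ) ^ 2) = 1 := fun x => by exact_mod_cast hAB1 x
  have hδ2 : (δ : ℂ) ^ 2 = 1 := by rcases hδ with rfl | rfl <;> norm_num
  have hσ : ε * δ = 1 ∨ ε * δ = -1 := by
    rcases hε with rfl | rfl <;> rcases hδ with rfl | rfl <;> simp
  have hσ2 : (ε * δ) ^ 2 = 1 := by rcases hσ with h | h <;> rw [h] <;> norm_num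
  -- the three families of sums required by the counting argument
  have hsum : ∑ x, A x = -(ε * δ) * m ∧ ∑ x, B x = -(m + 1) := by
    apply int_add_mul_I_inj
    have h1 : lineSum F χ α = z * (∑ x, (A x : ℂ) + (∑ x, (B x : ℂ)) * I) := by
      simp only [lineSum, hχAB, ← Finset.mul_sum, Finset.sum_add_distrib, Finset.sum_mul]
    rw [h1] at hline
    apply mul_left_cancel₀ (mul_ne_zero I_ne_zero (pow_ne_zero 2 hz0))
    push_cast
    linear_combination -hline - I ^ 2 * z ^ 2 * (m + 1) * hδ2
  have htw : ∀ s, ∑ x, quadraticChar F (x - s) * A x = ε * δ * m * B s - (m + 1) * A s ∧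
      ∑ x, quadraticChar F (x - s) * B x = ε * δ * m * A s + (m + 1) * B s + 1 := by
    intro s
    apply int_add_mul_I_inj
    have h1 : ∑ x : F, (quadraticChar F (x - s) : ℂ) * χ (1 + algebraMap F K x * α) =
        z * (∑ x, (quadraticChar F (x - s) : ℂ) * (A x : ℂ) +
          (∑ x, (quadraticChar F (x - s) : ℂ) * (B x : ℂ)) * I) := by
      rw [Finset.sum_mul, ← Finset.sum_add_distrib, Finset.mul_sum]
      refine Finset.sum_congr rfl fun x _ => ?_
      rw [hχAB]; ring
    have h3 := htwist s
    rw [h1, hχAB s] at h3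
    apply mul_left_cancel₀ (pow_ne_zero 2 hz0)
    push_cast
    set X := ∑ x, (quadraticChar F (x - s) : ℂ) * (A x : ℂ)
    set Y := ∑ x, (quadraticChar F (x - s) : ℂ) * (B x : ℂ)
    linear_combination (A s - B s * I) * h3 - z ^ 2 * (X + Y * I - I) * hABc s +
      (z ^ 2 * (X + Y * I - I) * B s ^ 2 -
        z ^ 2 * (ε * δ * m * B s + (m + 1) * (B s * I - A s))) * I_sq +
      z ^ 2 * (m + 1) * (I ^ 2 * A s - B s * I ^ 3) * hδ2
  have hsq : ∑ x, (A x ^ 2 - B x ^ 2) = 1 := by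
    have h1 : ∑ x : F, χ (1 + algebraMap F K x * α) ^ 2 =
        z ^ 2 * (∑ x, ((A x : ℂ) ^ 2 - (B x : ℂ) ^ 2) + (∑ x, 2 * (A x : ℂ) * (B x : ℂ)) * I) := by
      rw [Finset.sum_mul, ← Finset.sum_add_distrib, Finset.mul_sum]
      refine Finset.sum_congr rfl fun x _ => ?_
      rw [hχAB]
      linear_combination z ^ 2 * B x ^ 2 * I_sq
    refine (int_add_mul_I_inj (b := ∑ x, 2 * A x * B x) (d := 0) ?_).1
    apply mul_left_cancel₀ (pow_ne_zero 2 hz0)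
    push_cast
    rw [← h1, hsqsum]
    linear_combination -z ^ 2 * I_sq
  have hmem : ∀ (x : F) (c : ℂ), χ (1 + algebraMap F K x * α) = z * c ↔
      (A x + B x * I : ℂ) = c := fun x c => by
    rw [hχAB, mul_right_inj' hz0]
  have hmem₀ : ∀ x, (∃ j ∈ ({h, h + 1} : Set ℕ), χ (1 + algebraMap F K x * α) = I ^ j) ↔
      A x + B x = 1 := fun x => by
    rw [int_add_eq_one_iff (hAB1 x), ← hmem, ← hmem]
    simp [pow_succ, hz]
  have hmem₁ : ∀ x, (∃ j ∈ ({h + 1, h + 2} : Set ℕ), χ (1 + algebraMap F K x * α) = I ^ j) ↔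
      B x - A x = 1 := fun x => by
    rw [int_sub_eq_one_iff (hAB1 x), ← hmem, ← hmem]
    simp [pow_succ, hz, mul_assoc]
  -- the sign `ε δ` in front of `A` accounts for the exchange of the two index sets
  refine intersection_numbers (A := fun x => ε * δ * A x) (B := B) hm h2 (by rw [hq]; push_cast; rfl)
    (fun x => by rw [mul_pow, hσ2, one_mul, hAB1]) ?_ hsum.2 ?_ ?_ ?_ ?_ ?_
    (mem_cyclotomicClass_two_zero_iff hγ)
  · rw [← Finset.mul_sum, hsum.1]
    linear_combination (-(m : ℤ)) * hσ2
  · simpa only [mul_pow, hσ2, one_mul] using hsq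
  · intro s
    simp only [mul_left_comm _ (ε * δ), ← Finset.mul_sum, (htw s).1]
    linear_combination ((m : ℤ) * B s) * hσ2
  · intro s
    rw [(htw s).2]
    ring
  · intro x
    rw [hD, indexSet₀]
    rcases hσ with h' | h'
    · rw [h', if_pos rfl, hmem₀, one_mul]
    · rw [h', if_neg (by norm_num), hmem₁, neg_one_mul, sub_eq_neg_add]
  · intro x
    rw [hD, indexSet₁]
    rcases hσ with h' | h'
    · rw [h', if_pos rfl, hmem₁, one_mul]
    · rw [h', if_neg (by norm_num), hmem₀, neg_one_mul, sub_neg_eq_add, add_comm]
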